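/- All graphs are finite, simple and undirected, and $N(s)$ denotes the set of neighbours of $s$. A \emph{hole} is an induced cycle of length at least $4$. For $d\ge 2$, a \emph{$\dag$-AW} is the graph consisting of an induced path $b_0b_1\cdots b_{d+1}$, a vertex $c$ adjacent exactly to $b_1,\dots,b_d$ and $s$, and a vertex $s$ adjacent only to $c$. For $d\ge 1$, a \emph{$\ddag$-AW} is the graph consisting of an induced path $b_0b_1\cdots b_{d+1}$, two adjacent vertices $c_1,c_2$, where among the path vertices $c_1$ is adjacent exactly to $b_0,\dots,b_d$ and $c_2$ exactly to $b_1,\dots,b_{d+1}$, and a vertex $s$ adjacent exactly to $c_1$ and $c_2$. In both cases $\{b_1,\dots,b_d\}$ is the \emph{base}; if $d>3$ the graph is called \emph{long} and $s$ is its \emph{shallow terminal}. The \emph{small} asteroidal witnesses (AWs) are the $\dag$- and $\ddag$-AWs with $d\le 3$, the long claw (the claw $K_{1,3}$ with every edge subdivided once), and the whipping top (a path on five vertices, a vertex adjacent to all five of them, and a vertex adjacent only to the middle vertex of the path). The AWs are the small AWs and the long $\dag$- and $\ddag$-AWs. A graph is \emph{reduced} if it contains no hole and no small AW as an induced subgraph;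 thus every AW contained in a reduced graph as an induced subgraph is long. For a reduced graph $G$, let $ST(G)$ be the set of all vertices of $G$ that are the shallow terminal of some AW contained in $G$ as an induced subgraph. Lemma. Let $G$ be a reduced graph and let $s\in ST(G)$. Then $G$ contains, as an induced subgraph, an AW whose shallow terminal is $s$ and whose base is completely connected to $N(s)\setminus ST(G)$, i.e., every base vertex is adjacent to every vertex of $N(s)\setminus ST(G)$. Moreover, there is an algorithm that, given any reduced graph $G$ and any $s\in ST(G)$, finds such an AW in time polynomial in the number of vertices of $G$. -/

import Mathlib

namespace IntervalCompletion

/-! ### Asteroidal witnesses -/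

/-- Vertices of the `†`-AW: shallow terminal `s`, center `c`, and the path `b_0, …, b_{d+1}`. -/
inductive DagVertex (d : ℕ) : Type
  | s : DagVertex d
  | c : DagVertex d
  | b (i : Fin (d + 2)) : DagVertex d

/-- The edges of the `†`-AW, each in one orientation. -/
def dagRel (d : ℕ) : DagVertex d → DagVertex d → Prop
  | .s, .c => True
  | .c, .b i => 1 ≤ (i : ℕ) ∧ (i : ℕ) ≤ d
  | .b i, .b j => (i : ℕ) + 1 = j
  | _, _ => False

/-- The `†`-AW with `d` base vertices `b_1, …, b_d` and base terminals `b_0`, `b_{d+1}`. -/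
def dagGraph (d : ℕ) : SimpleGraph (DagVertex d) := SimpleGraph.fromRel (dagRel d)

/-- Vertices of the `‡`-AW: shallow terminal `s`, centers `c₁`, `c₂`, and the path
`b_0, …, b_{d+1}`. -/
inductive DdagVertex (d : ℕ) : Type
  | s : DdagVertex d
  | c₁ : DdagVertex d
  | c₂ : DdagVertex d
  | b (i : Fin (d + 2)) : DdagVertex d

/-- The edges of the `‡`-AW, each in one orientation. -/
def ddagRel (d : ℕ) : DdagVertex d → DdagVertex d → Prop
  | .s, .c₁ => True
  | .s, .c₂ => True
  | .c₁, .c₂ => True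
  | .c₁, .b i => (i : ℕ) ≤ d
  | .c₂, .b i => 1 ≤ (i : ℕ)
  | .b i, .b j => (i : ℕ) + 1 = j
  | _, _ => False

/-- The `‡`-AW with `d` base vertices `b_1, …, b_d` and base terminals `b_0`, `b_{d+1}`. -/
def ddagGraph (d : ℕ) : SimpleGraph (DdagVertex d) := SimpleGraph.fromRel (ddagRel d)

/-- The long claw: the claw with each edge subdivided once. -/
def longClaw : SimpleGraph (Fin 7) :=
  SimpleGraph.fromEdgeSet {s(0, 1), s(1, 2), s(0, 3), s(3, 4), s(0, 5), s(5, 6)}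

/-- The whipping top: the path `0 1 2 3 4`, a vertex `5` adjacent to the whole path, and a
vertex `6` adjacent to the middle vertex `2` of the path only. -/
def whippingTop : SimpleGraph (Fin 7) :=
  SimpleGraph.fromEdgeSet
    {s(0, 1), s(1, 2), s(2, 3), s(3, 4), s(5, 0), s(5, 1), s(5, 2), s(5, 3), s(5, 4), s(6, 2)}

universe u

/-- `G` contains a hole: an induced cycle of length at least `4`. -/
def HasHole {V : Type u} (G : SimpleGraph V) : Prop :=
  ∃ k : ℕ, 4 ≤ k ∧ (SimpleGraph.cycleGraph k).IsIndContained G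

/-- `G` contains a small AW as an induced subgraph: a long claw, a whipping top, a `†`-AW with
`2 ≤ d ≤ 3`, or a `‡`-AW with `1 ≤ d ≤ 3`. -/
def HasSmallAW {V : Type u} (G : SimpleGraph V) : Prop :=
  longClaw.IsIndContained G ∨ whippingTop.IsIndContained G ∨
    (∃ d : ℕ, 2 ≤ d ∧ d ≤ 3 ∧ (dagGraph d).IsIndContained G) ∨
    (∃ d : ℕ, 1 ≤ d ∧ d ≤ 3 ∧ (ddagGraph d).IsIndContained G)

/-- A graph is reduced if it contains no hole and no small AW. -/
def IsReduced {V : Type u} (G : SimpleGraph V) : Prop := ¬ HasHole G ∧ ¬ HasSmallAW G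

/-- A long AW of `G` (a `†`- or `‡`-AW with `d > 3`, as an induced subgraph of `G`), together with
its labelling.  In a reduced graph every AW is of this form. -/
inductive LongAW {V : Type u} (G : SimpleGraph V) : Type u
  | dag (d : ℕ) (hd : 3 < d) (f : dagGraph d ↪g G) : LongAW G
  | ddag (d : ℕ) (hd : 3 < d) (f : ddagGraph d ↪g G) : LongAW G

namespace LongAW

variable {V : Type u} {G : SimpleGraph V}

/-- The number of base vertices. -/
def d : LongAW G → ℕ
  | .dag d _ _ => d
  | .ddag d _ _ => d

/-- The shallow terminal. -/
def shallowTerminal : LongAW G → V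
  | .dag _ _ f => f .s
  | .ddag _ _ f => f .s

/-- The first center (the only center of a `†`-AW). -/
def c₁ : LongAW G → V
  | .dag _ _ f => f .c
  | .ddag _ _ f => f .c₁

/-- The second center (the only center of a `†`-AW). -/
def c₂ : LongAW G → V
  | .dag _ _ f => f .c
  | .ddag _ _ f => f .c₂

/-- The path `b_0, b_1, …, b_{d+1}` from one base terminal to the other. -/
def path : (W : LongAW G) → Fin (W.d + 2) → V
  | .dag _ _ f => fun i => f (.b i)
  | .ddag _ _ f => fun i => f (.b i)

/-- The base `{b_1, …, b_d}`: the inner vertices of the path. -/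
def base (W : LongAW G) : Set V :=
  {v | ∃ i : Fin (W.d + 2), 1 ≤ (i : ℕ) ∧ (i : ℕ) ≤ W.d ∧ v = W.path i}

end LongAW

/-- The set `ST(G)` of shallow terminals of the AWs of a reduced graph. -/
def ST {V : Type u} (G : SimpleGraph V) : Set V :=
  {v | ∃ W : LongAW G, W.shallowTerminal = v}

/-- `W` is an AW with shallow terminal `s` whose base is completely connected to
`N(s) \ ST(G)`. -/
def IsGoodAW {V : Type u} (G : SimpleGraph V) (s : V) (W : LongAW G) : Prop :=
  W.shallowTerminal = s ∧ ∀ v ∈ W.base, ∀ x ∈ G.neighborSet s \ ST G, G.Adj v x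

/-! ### A random access machine with step count

Programs are structured programs over finitely many registers and arrays that hold natural
numbers.  The available operations are constants, reading, addition, truncated subtraction and
comparison, each at unit cost.  (There is no multiplication, so a unit of cost at most doubles the
largest number in store, and polynomial time agrees with that of Turing machines.) -/

/-- A machine state: contents of the registers, and of the cells of the arrays. -/
structure State where
  reg : ℕ → ℕ
  arr : ℕ → ℕ → ℕ

/-- Expressions. -/
inductive Expr : Type
  | const (k : ℕ) : Expr
  | reg (x : ℕ) : Expr
  /-- the cell of array `a` at the index given by the expression `e` -/
  | read (a : ℕ) (e : Expr) : Expr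
  | add (e₁ e₂ : Expr) : Expr
  | sub (e₁ e₂ : Expr) : Expr
  /-- `1` if `e₁ < e₂`, and `0` otherwise -/
  | lt (e₁ e₂ : Expr) : Expr
  /-- `1` if `e₁ = e₂`, and `0` otherwise -/
  | eq (e₁ e₂ : Expr) : Expr

/-- The value of an expression in a state. -/
def Expr.eval (σ : State) : Expr → ℕ
  | .const k => k
  | .reg x => σ.reg x
  | .read a e => σ.arr a (e.eval σ)
  | .add e₁ e₂ => e₁.eval σ + e₂.eval σ
  | .sub e₁ e₂ => e₁.eval σ - e₂.eval σ
  | .lt e₁ e₂ => if e₁.eval σ < e₂.eval σ then 1 else 0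
  | .eq e₁ e₂ => if e₁.eval σ = e₂.eval σ then 1 else 0

/-- The number of steps taken to evaluate an expression: one for each operation in it. -/
def Expr.cost : Expr → ℕ
  | .const _ => 1
  | .reg _ => 1
  | .read _ e => e.cost + 1
  | .add e₁ e₂ => e₁.cost + e₂.cost + 1
  | .sub e₁ e₂ => e₁.cost + e₂.cost + 1
  | .lt e₁ e₂ => e₁.cost + e₂.cost + 1
  | .eq e₁ e₂ => e₁.cost + e₂.cost + 1

/-- Programs. -/
inductive Prog : Type
  | skip : Prog
  /-- assign the value of `e` to register `x` -/
  | assign (x : ℕ) (e : Expr) : Prog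
  /-- write the value of `e` into array `a` at the index given by `i` -/
  | write (a : ℕ) (i e : Expr) : Prog
  | seq (P Q : Prog) : Prog
  /-- run `P` if `e` is nonzero, and `Q` otherwise -/
  | branch (e : Expr) (P Q : Prog) : Prog
  /-- repeat `P` as long as `e` is nonzero -/
  | loop (e : Expr) (P : Prog) : Prog

/-- `Exec P σ t τ`: started in state `σ`, the program `P` halts after exactly `t` steps, in
state `τ`. -/
inductive Exec : Prog → State → ℕ → State → Prop
  | skip (σ : State) : Exec .skip σ 1 σ
  | assign (σ : State) (x : ℕ) (e : Expr) :
      Exec (.assign x e) σ (e.cost + 1) ⟨Function.update σ.reg x (e.eval σ), σ.arr⟩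
  | write (σ : State) (a : ℕ) (i e : Expr) :
      Exec (.write a i e) σ (i.cost + e.cost + 1)
        ⟨σ.reg, Function.update σ.arr a (Function.update (σ.arr a) (i.eval σ) (e.eval σ))⟩
  | seq {P Q : Prog} {σ τ ρ : State} {t u : ℕ} (hP : Exec P σ t τ) (hQ : Exec Q τ u ρ) :
      Exec (.seq P Q) σ (t + u) ρ
  | branch_true {e : Expr} {P Q : Prog} {σ τ : State} {t : ℕ} (he : e.eval σ ≠ 0)
      (hP : Exec P σ t τ) : Exec (.branch e P Q) σ (e.cost + 1 + t) τ
  | branch_false {e : Expr} {P Q : Prog} {σ τ : State} {t : ℕ} (he : e.eval σ = 0)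
      (hQ : Exec Q σ t τ) : Exec (.branch e P Q) σ (e.cost + 1 + t) τ
  | loop_done {e : Expr} {P : Prog} {σ : State} (he : e.eval σ = 0) :
      Exec (.loop e P) σ (e.cost + 1) σ
  | loop_step {e : Expr} {P : Prog} {σ τ ρ : State} {t u : ℕ} (he : e.eval σ ≠ 0)
      (hP : Exec P σ t τ) (hL : Exec (.loop e P) τ u ρ) :
      Exec (.loop e P) σ (e.cost + 1 + t + u) ρ

open Classical in
/-- The initial state on input `(G, s)`: register `0` holds the number `n` of vertices, register
`1` holds `s`, array `0` holds the adjacency matrix of `G` row by row (the entry of the pair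
`(i, j)` in cell `i * n + j`), and everything else is `0`. -/
noncomputable def inputState {n : ℕ} (G : SimpleGraph (Fin n)) (s : Fin n) : State where
  reg x := if x = 0 then n else if x = 1 then (s : ℕ) else 0
  arr a m :=
    if a = 0 ∧ ∃ i j : Fin n, m = (i : ℕ) * n + (j : ℕ) ∧ G.Adj i j then 1 else 0

/-- A long AW written as the list `d, s, c₁, c₂, b_0, …, b_{d+1}` (with `c₁ = c₂` for a
`†`-AW). -/
def LongAW.toList {n : ℕ} {G : SimpleGraph (Fin n)} (W : LongAW G) : List ℕ :=
  [W.d, (W.shallowTerminal : ℕ), (W.c₁ : ℕ), (W.c₂ : ℕ)] ++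
    List.ofFn (fun i : Fin (W.d + 2) => (W.path i : ℕ))

/-- The output of a computation, in array `1` of the final state, is the list `L`. -/
def State.Outputs (σ : State) (L : List ℕ) : Prop :=
  ∀ i : Fin L.length, σ.arr 1 i = L.get i

end IntervalCompletion

/-! ### Asteroidal witnesses in a common format -/

namespace IntervalCompletion

universe u

/-! Among all long AWs with shallow terminal `s`, one with the fewest base vertices works. Let `x`
be a neighbour of `s` outside `ST G`. If `x` is a center, it sees the base. Otherwise `x` is
adjacent to both centers, since each other pattern creates a hole or a small AW (`adj_centers`). If
`x` had no neighbour on the path, it could take the place of `s` and would lie in `ST G`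
(`replace_shallow`). So `x` has a neighbour on the path, and as there are no holes its neighbours
there form an interval. If `x` missed a base vertex, this interval would end before one of the two
ends of the base. Depending on where it starts and how long it is, one finds a hole, a small AW, or
an AW with shallow terminal `s` and fewer base vertices in which `x` is a center
(`exists_shorter_of_lt`). Each case contradicts reducedness or minimality. Reversing the path and
swapping the centers is a symmetry of AWs and halves the casework.

The algorithm therefore only has to minimize the base, and it never computes `ST G`. For each choice
of centers `c₁`, `c₂` and base terminals `u`, `w` it finds a shortest path from `u` to `w` whose
inner vertices are adjacent to both centers, not adjacent to `s`, and different from `s`. A shortest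
path is induced, so it completes an AW (`IsDist.isAW`). If the four vertices come from some long AW,
reducedness forces the shortest path to give a long AW again (`four_lt_dist`), so the minimum over
all choices is the true one. The program uses only loops of length `n`. Its running time is bounded
by a polynomial read off from its syntax (`exec_compile`), and distances are computed by repeated
relaxation of all edges (`relax_spec`). -/

/-- `b_0, …, b_m` is an induced path of `G`. -/
structure IsInducedPath {V : Type u} (G : SimpleGraph V) (m : ℕ) (b : ℕ → V) : Prop where
  inj : ∀ i ≤ m, ∀ j ≤ m, b i = b j → i = j
  adj : ∀ i ≤ m, ∀ j ≤ m, (G.Adj (b i) (b j) ↔ i + 1 = j ∨ j + 1 = i)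

/-- The `†`- and `‡`-AWs in one format: shallow terminal `s`, centers `c₁`, `c₂` (equal for a
`†`-AW) and the path `b_0, …, b_{d+1}`. -/
structure IsAW {V : Type u} (G : SimpleGraph V) (s c₁ c₂ : V) (d : ℕ) (b : ℕ → V) : Prop where
  path : IsInducedPath G (d + 1) b
  s_c₁ : G.Adj s c₁
  s_c₂ : G.Adj s c₂
  s_b : ∀ i ≤ d + 1, ¬ G.Adj s (b i)
  c₁_b : ∀ i, 1 ≤ i → i ≤ d → G.Adj c₁ (b i)
  c₂_b : ∀ i, 1 ≤ i → i ≤ d → G.Adj c₂ (b i)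
  c₁_last : ¬ G.Adj c₁ (b (d + 1))
  c₂_first : ¬ G.Adj c₂ (b 0)
  centers : c₁ = c₂ ∨ G.Adj c₁ c₂ ∧ G.Adj c₁ (b 0) ∧ G.Adj c₂ (b (d + 1))

variable {V : Type u} {G : SimpleGraph V}

/-! ### Recognizing holes and small AWs -/

theorem cycleGraph_adj_iff_val {k : ℕ} (hk : 4 ≤ k) (i j : Fin k) :
    (SimpleGraph.cycleGraph k).Adj i j ↔ (i : ℕ) + 1 = j ∨ (j : ℕ) + 1 = i ∨
      ((i : ℕ) = 0 ∧ (j : ℕ) + 1 = k) ∨ ((j : ℕ) = 0 ∧ (i : ℕ) + 1 = k) := by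
  rw [SimpleGraph.cycleGraph_adj']
  rcases lt_trichotomy i j with h | rfl | h
  · rw [Fin.sub_val_of_le h.le, Fin.coe_sub_iff_lt.2 h]; omega
  · have : i - i = ⟨0, by omega⟩ := by rw [Fin.ext_iff, Fin.sub_val_of_le le_rfl]; simp
    rw [this]; simp; omega
  · rw [Fin.sub_val_of_le h.le, Fin.coe_sub_iff_lt.2 h]; omega

theorem HasHole.of_fun {k : ℕ} (hk : 4 ≤ k) (f : ℕ → V)
    (hinj : ∀ i < k, ∀ j < k, f i = f j → i = j)
    (hadj : ∀ i j, i < j → j < k → (G.Adj (f i) (f j) ↔ i + 1 = j ∨ i = 0 ∧ j + 1 = k)) :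
    HasHole G := by
  refine ⟨k, hk, ⟨⟨⟨fun i : Fin k => f i, ?_⟩, ?_⟩⟩⟩
  · intro i j e
    exact Fin.ext (hinj _ i.2 _ j.2 e)
  intro i j
  change G.Adj (f i) (f j) ↔ _
  rw [cycleGraph_adj_iff_val hk]
  rcases lt_trichotomy (i : ℕ) j with h | h | h
  · rw [hadj _ _ h j.2]; omega
  · rw [h]; simp; omega
  · rw [G.adj_comm, hadj _ _ h i.2]; omega

/-- A map that preserves and reflects adjacency can only identify vertices with the same neighbours.
When `H` has no such twins, injectivity is automatic, so the seven vertices of a long claw or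
whipping top need not be checked to be distinct. -/
theorem isIndContained_of_adj_iff {W : Type*} {H : SimpleGraph W} (f : W → V)
    (htwin : ∀ i j, (∀ k, H.Adj i k ↔ H.Adj j k) → i = j)
    (hadj : ∀ i j, G.Adj (f i) (f j) ↔ H.Adj i j) : H.IsIndContained G :=
  ⟨⟨⟨f, fun i j e => htwin i j fun k => by rw [← hadj, ← hadj, e]⟩, hadj _ _⟩⟩

instance : DecidableRel whippingTop.Adj := fun i j =>
  decidable_of_iff (s(i, j) ∈ ([s(0, 1), s(1, 2), s(2, 3), s(3, 4), s(5, 0), s(5, 1), s(5, 2),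
    s(5, 3), s(5, 4), s(6, 2)] : List (Sym2 (Fin 7))) ∧ i ≠ j) (by simp [whippingTop])
instance : DecidableRel longClaw.Adj := fun i j =>
  decidable_of_iff (s(i, j) ∈ ([s(0, 1), s(1, 2), s(0, 3), s(3, 4), s(0, 5), s(5, 6)] :
    List (Sym2 (Fin 7))) ∧ i ≠ j) (by simp [longClaw])

theorem adj_iff_of_lt {n : ℕ} {H : SimpleGraph (Fin n)} {f : Fin n → V}
    (h : ∀ i j, i < j → (G.Adj (f i) (f j) ↔ H.Adj i j)) (i j : Fin n) :
    G.Adj (f i) (f j) ↔ H.Adj i j := by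
  rcases lt_trichotomy i j with hij | rfl | hij
  · exact h i j hij
  · simp
  · rw [G.adj_comm, H.adj_comm, h j i hij]

theorem HasSmallAW.of_whippingTop {a₀ a₁ a₂ a₃ a₄ a₅ a₆ : V}
    (h01 : G.Adj a₀ a₁) (h02 : ¬ G.Adj a₀ a₂) (h03 : ¬ G.Adj a₀ a₃) (h04 : ¬ G.Adj a₀ a₄)
    (h05 : G.Adj a₀ a₅) (h06 : ¬ G.Adj a₀ a₆) (h12 : G.Adj a₁ a₂) (h13 : ¬ G.Adj a₁ a₃)
    (h14 : ¬ G.Adj a₁ a₄) (h15 : G.Adj a₁ a₅) (h16 : ¬ G.Adj a₁ a₆) (h23 : G.Adj a₂ a₃)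
    (h24 : ¬ G.Adj a₂ a₄) (h25 : G.Adj a₂ a₅) (h26 : G.Adj a₂ a₆) (h34 : G.Adj a₃ a₄)
    (h35 : G.Adj a₃ a₅) (h36 : ¬ G.Adj a₃ a₆) (h45 : G.Adj a₄ a₅) (h46 : ¬ G.Adj a₄ a₆)
    (h56 : ¬ G.Adj a₅ a₆) : HasSmallAW G := by
  refine Or.inr (Or.inl (isIndContained_of_adj_iff ![a₀, a₁, a₂, a₃, a₄, a₅, a₆]
    (by decide) (adj_iff_of_lt ?_)))
  simp only [Fin.forall_fin_succ, Fin.forall_fin_zero]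
  simp [whippingTop, *]

theorem HasSmallAW.of_longClaw {a₀ a₁ a₂ a₃ a₄ a₅ a₆ : V}
    (h01 : G.Adj a₀ a₁) (h12 : G.Adj a₁ a₂) (h03 : G.Adj a₀ a₃) (h34 : G.Adj a₃ a₄)
    (h05 : G.Adj a₀ a₅) (h56 : G.Adj a₅ a₆)
    (h02 : ¬ G.Adj a₀ a₂) (h04 : ¬ G.Adj a₀ a₄) (h06 : ¬ G.Adj a₀ a₆) (h13 : ¬ G.Adj a₁ a₃)
    (h14 : ¬ G.Adj a₁ a₄) (h15 : ¬ G.Adj a₁ a₅) (h16 : ¬ G.Adj a₁ a₆) (h23 : ¬ G.Adj a₂ a₃)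
    (h24 : ¬ G.Adj a₂ a₄) (h25 : ¬ G.Adj a₂ a₅) (h26 : ¬ G.Adj a₂ a₆) (h35 : ¬ G.Adj a₃ a₅)
    (h36 : ¬ G.Adj a₃ a₆) (h45 : ¬ G.Adj a₄ a₅) (h46 : ¬ G.Adj a₄ a₆) : HasSmallAW G := by
  refine Or.inl (isIndContained_of_adj_iff ![a₀, a₁, a₂, a₃, a₄, a₅, a₆]
    (by decide) (adj_iff_of_lt ?_))
  simp only [Fin.forall_fin_succ, Fin.forall_fin_zero]
  simp [longClaw, *]

/-! ### Neighbours of a vertex on an induced path -/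

namespace IsInducedPath

variable {m : ℕ} {b : ℕ → V}

theorem reverse (h : IsInducedPath G m b) : IsInducedPath G m (fun i => b (m - i)) where
  inj i hi j hj e := by
    have := h.inj (m - i) (by omega) (m - j) (by omega) e
    omega
  adj i hi j hj := by
    rw [h.adj (m - i) (by omega) (m - j) (by omega)]
    omega

theorem segment (h : IsInducedPath G m b) {p l : ℕ} (hl : p + l ≤ m) :
    IsInducedPath G l (fun i => b (p + i)) where
  inj i hi j hj e := by
    have := h.inj (p + i) (by omega) (p + j) (by omega) e
    omega
  adj i hi j hj := by
    rw [h.adj (p + i) (by omega) (p + j) (by omega)]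
    omega

/-- A vertex adjacent to the two ends of an induced path of length at least two, and to none of its
inner vertices, closes a hole. -/
theorem hasHole (h : IsInducedPath G m b) (hm : 2 ≤ m) {x : V} (hx : ∀ i ≤ m, x ≠ b i)
    (h0 : G.Adj x (b 0)) (h1 : G.Adj x (b m)) (h2 : ∀ i, 0 < i → i < m → ¬ G.Adj x (b i)) :
    HasHole G := by
  have key : ∀ i ≤ m, (G.Adj (b i) x ↔ i = 0 ∨ i = m) := by
    intro i hi
    rw [G.adj_comm]
    by_cases e0 : i = 0
    · subst e0; simp [h0]
    by_cases e1 : i = m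
    · subst e1; simp [h1]
    simpa [e0, e1] using h2 i (by omega) (by omega)
  refine HasHole.of_fun (k := m + 2) (by omega) (fun i => if i ≤ m then b i else x) ?_ ?_
  · intro i hi j hj e
    by_cases hi' : i ≤ m <;> by_cases hj' : j ≤ m <;> simp only [hi', hj', if_true, if_false] at e
    · exact h.inj i hi' j hj' e
    · exact absurd e.symm (hx i hi')
    · exact absurd e (hx j hj')
    · omega
  · intro i j hij hj
    have hi' : i ≤ m := by omega
    by_cases hj' : j ≤ m <;> simp only [hi', hj', if_true, if_false]
    · rw [h.adj i hi' j hj']; omega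
    · rw [key i hi']; omega

/-- In a graph without holes the neighbors of a vertex on an induced path are consecutive. -/
theorem adj_of_adj_of_adj (h : IsInducedPath G m b) (hG : ¬ HasHole G) {x : V}
    (hx : ∀ i ≤ m, x ≠ b i) {i j k : ℕ} (hik : i ≤ k) (hkj : k ≤ j) (hj : j ≤ m)
    (hi' : G.Adj x (b i)) (hj' : G.Adj x (b j)) : G.Adj x (b k) := by
  classical
  by_contra hk
  -- The neighbours of `x` nearest to `b k` on either side are `b (k - r₁)` and `b (k + r₂)`.
  -- Between them `x` has no neighbour, so that segment and `x` form a hole.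
  have e₁ : ∃ r, G.Adj x (b (k - r)) := ⟨k - i, by rwa [Nat.sub_sub_self hik]⟩
  have e₂ : ∃ r, G.Adj x (b (k + r)) := ⟨j - k, by rwa [Nat.add_sub_cancel' hkj]⟩
  have l₁ : Nat.find e₁ ≤ k - i := Nat.find_min' e₁ (by rwa [Nat.sub_sub_self hik])
  have l₂ : Nat.find e₂ ≤ j - k := Nat.find_min' e₂ (by rwa [Nat.add_sub_cancel' hkj])
  have m₁ := fun r => Nat.find_min e₁ (m := r)
  have m₂ := fun r => Nat.find_min e₂ (m := r)
  have s₁ := Nat.find_spec e₁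
  have s₂ := Nat.find_spec e₂
  generalize Nat.find e₁ = r₁ at *
  generalize Nat.find e₂ = r₂ at *
  have z₁ : r₁ ≠ 0 := by rintro rfl; exact hk s₁
  have z₂ : r₂ ≠ 0 := by rintro rfl; exact hk s₂
  refine hG ((h.segment (p := k - r₁) (l := r₁ + r₂) (by omega)).hasHole (by omega)
    (fun t ht => hx _ (by omega)) s₁ ?_ ?_)
  · rwa [show k - r₁ + (r₁ + r₂) = k + r₂ by omega]
  · intro t ht ht'
    rcases lt_trichotomy t r₁ with h' | h' | h'
    · rw [show k - r₁ + t = k - (r₁ - t) by omega]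
      exact m₁ _ (by omega)
    · rwa [show k - r₁ + t = k by omega]
    · rw [show k - r₁ + t = k + (t - r₁) by omega]
      exact m₂ _ (by omega)

end IsInducedPath

/-! ### Passing between `IsAW` and `LongAW` -/

namespace IsAW

variable {s c₁ c₂ : V} {d : ℕ} {b : ℕ → V}

theorem reverse (h : IsAW G s c₁ c₂ d b) : IsAW G s c₂ c₁ d (fun i => b (d + 1 - i)) where
  path := h.path.reverse
  s_c₁ := h.s_c₂
  s_c₂ := h.s_c₁
  s_b i _ := h.s_b _ (by omega)
  c₁_b i _ _ := h.c₂_b _ (by omega) (by omega)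
  c₂_b i _ _ := h.c₁_b _ (by omega) (by omega)
  c₁_last := by simpa using h.c₂_first
  c₂_first := h.c₁_last
  centers := by
    rcases h.centers with e | ⟨e₁, e₂, e₃⟩
    · exact Or.inl e.symm
    · exact Or.inr ⟨e₁.symm, e₃, by simpa using e₂⟩

/-- Distinctness is not part of `IsAW` because it follows. The vertex `b 0` is told from `s` by
`c₂`, and any later `b i` by its neighbour `b (i - 1)`. -/
theorem s_ne_b (h : IsAW G s c₁ c₂ d b) (i : ℕ) (hi : i ≤ d + 1) : s ≠ b i := by
  intro e
  rcases Nat.eq_zero_or_pos i with h0 | h0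
  · subst h0
    exact h.c₂_first (e ▸ h.s_c₂.symm)
  · exact h.s_b (i - 1) (by omega) (e ▸ (h.path.adj i hi (i - 1) (by omega)).2 (by omega))

theorem ne_b (h : IsAW G s c₁ c₂ d b) {x : V} (hx : G.Adj s x) (i : ℕ) (hi : i ≤ d + 1) :
    x ≠ b i := by
  rintro rfl
  exact h.s_b i hi hx

theorem nonempty_dag (h : IsAW G s c₁ c₁ d b) :
    ∃ f : dagGraph d ↪g G, f .s = s ∧ f .c = c₁ ∧ ∀ i, f (.b i) = b i := by
  have hs := h.s_ne_b
  have hc := fun i hi => h.ne_b h.s_c₁ i hi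
  have hsc := h.s_c₁.ne
  have hcb : ∀ i ≤ d + 1, (G.Adj c₁ (b i) ↔ 1 ≤ i ∧ i ≤ d) := by
    intro i hi
    by_cases e0 : i = 0
    · subst e0; simpa using h.c₂_first
    by_cases e1 : i = d + 1
    · subst e1; simpa using h.c₁_last
    exact iff_of_true (h.c₁_b i (by omega) (by omega)) (by omega)
  let f : DagVertex d → V
    | .s => s
    | .c => c₁
    | .b i => b i
  have hinj : Function.Injective f := by
    rintro (_ | _ | i) (_ | _ | j) e <;> simp only [f] at e
    · rfl
    · exact absurd e hsc
    · exact absurd e (hs _ (by omega))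
    · exact absurd e.symm hsc
    · rfl
    · exact absurd e (hc _ (by omega))
    · exact absurd e.symm (hs _ (by omega))
    · exact absurd e.symm (hc _ (by omega))
    · rw [Fin.ext (h.path.inj i (by omega) j (by omega) e)]
  have hadj : ∀ a b, G.Adj (f a) (f b) ↔ (dagGraph d).Adj a b := by
    rintro (_ | _ | i) (_ | _ | j) <;>
      simp only [f, dagGraph, SimpleGraph.fromRel_adj, dagRel]
    · simp
    · simp [h.s_c₁]
    · simp [h.s_b j (by omega)]
    · simp [h.s_c₁.symm]
    · simp
    · simp [hcb j (by omega)]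
    · rw [G.adj_comm]; simp [h.s_b i (by omega)]
    · rw [G.adj_comm]; simp [hcb i (by omega)]
    · rw [h.path.adj i (by omega) j (by omega)]
      simp only [ne_eq, DagVertex.b.injEq, Fin.ext_iff]
      omega
  exact ⟨⟨⟨f, hinj⟩, hadj _ _⟩, rfl, rfl, fun _ => rfl⟩

theorem nonempty_ddag (h : IsAW G s c₁ c₂ d b) (hne : c₁ ≠ c₂) :
    ∃ f : ddagGraph d ↪g G, f .s = s ∧ f .c₁ = c₁ ∧ f .c₂ = c₂ ∧ ∀ i, f (.b i) = b i := by
  have hs := h.s_ne_b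
  have hc₁ := fun i hi => h.ne_b h.s_c₁ i hi
  have hc₂ := fun i hi => h.ne_b h.s_c₂ i hi
  obtain ⟨hcc, hc0, hcd⟩ := h.centers.resolve_left hne
  have hcb₁ : ∀ i ≤ d + 1, (G.Adj c₁ (b i) ↔ i ≤ d) := by
    intro i hi
    by_cases e0 : i = 0
    · subst e0; simpa using hc0
    by_cases e1 : i = d + 1
    · subst e1; simpa using h.c₁_last
    exact iff_of_true (h.c₁_b i (by omega) (by omega)) (by omega)
  have hcb₂ : ∀ i ≤ d + 1, (G.Adj c₂ (b i) ↔ 1 ≤ i) := by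
    intro i hi
    by_cases e0 : i = 0
    · subst e0; simpa using h.c₂_first
    by_cases e1 : i = d + 1
    · subst e1; simpa using hcd
    exact iff_of_true (h.c₂_b i (by omega) (by omega)) (by omega)
  let f : DdagVertex d → V
    | .s => s
    | .c₁ => c₁
    | .c₂ => c₂
    | .b i => b i
  have hinj : Function.Injective f := by
    rintro (_ | _ | _ | i) (_ | _ | _ | j) e <;> simp only [f] at e <;> first
    | rfl
    | exact absurd e h.s_c₁.ne
    | exact absurd e.symm h.s_c₁.ne
    | exact absurd e h.s_c₂.ne
    | exact absurd e.symm h.s_c₂.ne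
    | exact absurd e hne
    | exact absurd e.symm hne
    | exact absurd e (hs _ (by omega))
    | exact absurd e.symm (hs _ (by omega))
    | exact absurd e (hc₁ _ (by omega))
    | exact absurd e.symm (hc₁ _ (by omega))
    | exact absurd e (hc₂ _ (by omega))
    | exact absurd e.symm (hc₂ _ (by omega))
    | rw [Fin.ext (h.path.inj i (by omega) j (by omega) e)]
  have hadj : ∀ a b, G.Adj (f a) (f b) ↔ (ddagGraph d).Adj a b := by
    rintro (_ | _ | _ | i) (_ | _ | _ | j) <;>
      simp only [f, ddagGraph, SimpleGraph.fromRel_adj, ddagRel]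
    · simp
    · simp [h.s_c₁]
    · simp [h.s_c₂]
    · simp [h.s_b j (by omega)]
    · simp [h.s_c₁.symm]
    · simp
    · simp [hcc]
    · simp [hcb₁ j (by omega)]
    · simp [h.s_c₂.symm]
    · simp [hcc.symm]
    · simp
    · simp [hcb₂ j (by omega)]
    · rw [G.adj_comm]; simp [h.s_b i (by omega)]
    · rw [G.adj_comm]; simp [hcb₁ i (by omega)]
    · rw [G.adj_comm]; simp [hcb₂ i (by omega)]
    · rw [h.path.adj i (by omega) j (by omega)]
      simp only [ne_eq, DdagVertex.b.injEq, Fin.ext_iff]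
      omega
  exact ⟨⟨⟨f, hinj⟩, hadj _ _⟩, rfl, rfl, rfl, fun _ => rfl⟩

/-- Every AW of a reduced graph is long. -/
theorem three_lt (h : IsAW G s c₁ c₂ d b) (hG : IsReduced G)
    (hd : 2 ≤ d ∨ 1 ≤ d ∧ c₁ ≠ c₂) : 3 < d := by
  by_contra hlt
  by_cases e : c₁ = c₂
  · subst e
    obtain ⟨f, -⟩ := h.nonempty_dag
    exact hG.2 (Or.inr (Or.inr (Or.inl ⟨d, by simpa using hd, by omega, ⟨f⟩⟩)))
  · obtain ⟨f, -⟩ := h.nonempty_ddag e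
    exact hG.2 (Or.inr (Or.inr (Or.inr ⟨d, by omega, by omega, ⟨f⟩⟩)))

theorem exists_longAW (h : IsAW G s c₁ c₂ d b) (hd : 3 < d) :
    ∃ W : LongAW G, W.d = d ∧ W.shallowTerminal = s ∧ W.c₁ = c₁ ∧ W.c₂ = c₂ ∧
      ∀ i, W.path i = b i := by
  by_cases e : c₁ = c₂
  · subst e
    obtain ⟨f, h₁, h₂, h₃⟩ := h.nonempty_dag
    exact ⟨.dag d hd f, rfl, h₁, h₂, h₂, h₃⟩
  · obtain ⟨f, h₁, h₂, h₃, h₄⟩ := h.nonempty_ddag e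
    exact ⟨.ddag d hd f, rfl, h₁, h₂, h₃, h₄⟩

end IsAW

theorem LongAW.exists_isAW (W : LongAW G) :
    3 < W.d ∧ ∃ b : ℕ → V, IsAW G W.shallowTerminal W.c₁ W.c₂ W.d b ∧ ∀ i, W.path i = b i := by
  rcases W with ⟨d, hd, f⟩ | ⟨d, hd, f⟩ <;> simp only [LongAW.d, LongAW.shallowTerminal,
    LongAW.c₁, LongAW.c₂, LongAW.path]
  · have hA : ∀ a b, G.Adj (f a) (f b) ↔ a ≠ b ∧ (dagRel d a b ∨ dagRel d b a) :=
      fun _ _ => f.map_adj_iff.trans (SimpleGraph.fromRel_adj _ _ _)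
    have hb : ∀ i (hi : i ≤ d + 1),
        (if h : i < d + 2 then f (.b ⟨i, h⟩) else f .s) = f (.b ⟨i, by omega⟩) :=
      fun i hi => dif_pos (by omega)
    -- The value `f .s` beyond index `d + 1` is arbitrary, as `IsAW` constrains only indices up to
    -- `d + 1`.
    refine ⟨hd, fun i => if h : i < d + 2 then f (.b ⟨i, h⟩) else f .s,
      ⟨⟨?_, ?_⟩, ?_, ?_, ?_, ?_, ?_, ?_, ?_, Or.inl rfl⟩, ?_⟩
    · intro i hi j hj e
      simpa [hb i hi, hb j hj] using e
    · intro i hi j hj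
      simp only [hb i hi, hb j hj, hA, dagRel]
      simp only [ne_eq, DagVertex.b.injEq, Fin.ext_iff]
      omega
    · simp [hA, dagRel]
    · simp [hA, dagRel]
    · intro i hi
      simp only [hb i hi]
      simp [hA, dagRel]
    · intro i h1 h2
      simp only [hb i (by omega)]
      simp [hA, dagRel, h1, h2]
    · intro i h1 h2
      simp only [hb i (by omega)]
      simp [hA, dagRel, h1, h2]
    · simp [hA, dagRel]
    · simp [hA, dagRel]
    · intro i
      simp
  · have hA : ∀ a b, G.Adj (f a) (f b) ↔ a ≠ b ∧ (ddagRel d a b ∨ ddagRel d b a) :=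
      fun _ _ => f.map_adj_iff.trans (SimpleGraph.fromRel_adj _ _ _)
    have hb : ∀ i (hi : i ≤ d + 1),
        (if h : i < d + 2 then f (.b ⟨i, h⟩) else f .s) = f (.b ⟨i, by omega⟩) :=
      fun i hi => dif_pos (by omega)
    refine ⟨hd, fun i => if h : i < d + 2 then f (.b ⟨i, h⟩) else f .s,
      ⟨⟨?_, ?_⟩, ?_, ?_, ?_, ?_, ?_, ?_, ?_, Or.inr ⟨?_, ?_, ?_⟩⟩, ?_⟩
    · intro i hi j hj e
      simpa [hb i hi, hb j hj] using e
    · intro i hi j hj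
      simp only [hb i hi, hb j hj, hA, ddagRel]
      simp only [ne_eq, DdagVertex.b.injEq, Fin.ext_iff]
      omega
    · simp [hA, ddagRel]
    · simp [hA, ddagRel]
    · intro i hi
      simp only [hb i hi]
      simp [hA, ddagRel]
    · intro i h1 h2
      simp only [hb i (by omega)]
      simp [hA, ddagRel, h2]
    · intro i h1 h2
      simp only [hb i (by omega)]
      simp [hA, ddagRel, h1]
    · simp [hA, ddagRel]
    · simp [hA, ddagRel]
    · simp [hA, ddagRel]
    · simp [hA, ddagRel]
    · simp [hA, ddagRel]
    · intro i
      simp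

end IntervalCompletion

/-! ### Neighbours of the shallow terminal, and AWs with the fewest base vertices -/

namespace IntervalCompletion

universe u

variable {V : Type u} {G : SimpleGraph V} {s c₁ c₂ x : V} {d : ℕ} {b : ℕ → V}

/-- Opposite vertices of a square are twins, so here, unlike for the pentagon, their distinctness
must be assumed. -/
theorem HasHole.of_square {a₀ a₁ a₂ a₃ : V} (h01 : G.Adj a₀ a₁) (h12 : G.Adj a₁ a₂)
    (h23 : G.Adj a₂ a₃) (h30 : G.Adj a₃ a₀) (h02 : ¬ G.Adj a₀ a₂) (h13 : ¬ G.Adj a₁ a₃)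
    (n02 : a₀ ≠ a₂) (n13 : a₁ ≠ a₃) : HasHole G := by
  refine HasHole.of_fun (k := 4) le_rfl
    (fun i => if i = 0 then a₀ else if i = 1 then a₁ else if i = 2 then a₂ else a₃) ?_ ?_
  · have := h01.ne; have := h12.ne; have := h23.ne; have := h30.ne
    intro i hi j hj
    interval_cases i <;> interval_cases j <;> simp_all [eq_comm]
  · intro i j hij hj
    interval_cases j <;> interval_cases i <;> simp_all [G.adj_comm]

theorem HasHole.of_pentagon {a₀ a₁ a₂ a₃ a₄ : V} (h01 : G.Adj a₀ a₁) (h12 : G.Adj a₁ a₂)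
    (h23 : G.Adj a₂ a₃) (h34 : G.Adj a₃ a₄) (h40 : G.Adj a₄ a₀) (h02 : ¬ G.Adj a₀ a₂)
    (h13 : ¬ G.Adj a₁ a₃) (h24 : ¬ G.Adj a₂ a₄) (h30 : ¬ G.Adj a₃ a₀) (h41 : ¬ G.Adj a₄ a₁) :
    HasHole G := by
  refine HasHole.of_fun (k := 5) (by omega) (fun i => if i = 0 then a₀ else if i = 1 then a₁ else
    if i = 2 then a₂ else if i = 3 then a₃ else a₄) ?_ ?_
  · have := h01.ne; have := h12.ne; have := h23.ne; have := h34.ne; have := h40.ne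
    have : a₀ ≠ a₂ := by rintro rfl; exact h30 h23.symm
    have : a₁ ≠ a₃ := by rintro rfl; exact h41 h34.symm
    have : a₂ ≠ a₄ := by rintro rfl; exact h02 h40.symm
    have : a₃ ≠ a₀ := by rintro rfl; exact h13 h01.symm
    have : a₄ ≠ a₁ := by rintro rfl; exact h24 h12.symm
    intro i hi j hj
    interval_cases i <;> interval_cases j <;> simp_all [eq_comm]
  · intro i j hij hj
    interval_cases j <;> interval_cases i <;> simp_all [G.adj_comm]

namespace IsAW

theorem adj_succ (h : IsAW G s c₁ c₂ d b) {i : ℕ} (hi : i ≤ d) : G.Adj (b i) (b (i + 1)) :=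
  (h.path.adj i (by omega) (i + 1) (by omega)).2 (Or.inl rfl)

theorem not_adj (h : IsAW G s c₁ c₂ d b) {i j : ℕ} (hij : i + 1 < j) (hj : j ≤ d + 1) :
    ¬ G.Adj (b i) (b j) := fun e => by
  have := (h.path.adj i (by omega) j (by omega)).1 e
  omega

/-- Otherwise `x`, `s`, `c`, `b i` would be an induced square. -/
theorem not_adj_b_of_not_adj (h : IsAW G s c₁ c₂ d b) (hG : IsReduced G) (hx : G.Adj s x) {c : V}
    (hc : G.Adj s c) (hxc : ¬ G.Adj x c) (hne : x ≠ c) {i : ℕ} (hi : i ≤ d + 1)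
    (hcb : G.Adj c (b i)) : ¬ G.Adj x (b i) := fun e =>
  hG.1 (HasHole.of_square hx.symm hc hcb e.symm hxc (h.s_b i hi) hne (h.s_ne_b i hi))

/-- A neighbor of the shallow terminal of a long `†`-AW is adjacent to its center. -/
theorem adj_center (h : IsAW G s c₁ c₁ d b) (hG : IsReduced G) (hd : 3 < d)
    (hx : G.Adj s x) (hne : x ≠ c₁) : G.Adj x c₁ := by
  by_contra hn
  have hb : ∀ i, 1 ≤ i → i ≤ d → ¬ G.Adj x (b i) := fun i h1 h2 =>
    h.not_adj_b_of_not_adj hG hx h.s_c₁ hn hne (by omega) (h.c₁_b i h1 h2)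
  -- Otherwise `x`, `b' 0`, `b' 1`, `c₁`, `s` form an induced pentagon. The path is left general so
  -- that the reversed path covers the other end.
  have key : ∀ {b' : ℕ → V}, IsAW G s c₁ c₁ d b' → ¬ G.Adj x (b' 1) → ¬ G.Adj x (b' 0) := by
    intro b' h' h1 h0
    refine hG.1 (HasHole.of_pentagon h0 (h'.adj_succ (i := 0) (by omega))
      (h'.c₁_b 1 le_rfl (by omega)).symm h'.s_c₁.symm hx h1 ?_ ?_ (fun e => hn e.symm)
      (h'.s_b 0 (by omega)))
    · exact fun e => h'.c₂_first e.symm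
    · exact fun e => h'.s_b 1 (by omega) e.symm
  have h0 := key h (hb 1 le_rfl (by omega))
  have h1 : ¬ G.Adj x (b (d + 1)) := by
    simpa using key h.reverse (by simpa using hb d (by omega) le_rfl)
  have hb1 := h.c₁_b 1 le_rfl (by omega)
  have hbd := h.c₁_b d (by omega) le_rfl
  -- A long claw at `c₁` with legs `s x`, `b 1 b 0` and `b d b (d + 1)`.
  exact hG.2 (HasSmallAW.of_longClaw (a₀ := c₁) (a₁ := s) (a₂ := x) (a₃ := b 1) (a₄ := b 0)
    (a₅ := b d) (a₆ := b (d + 1)) h.s_c₁.symm hx hb1 (h.adj_succ (i := 0) (by omega)).symm hbd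
    (h.adj_succ le_rfl) (fun e => hn e.symm) h.c₂_first h.c₁_last (h.s_b _ (by omega))
    (h.s_b _ (by omega)) (h.s_b _ (by omega)) (h.s_b _ (by omega)) (hb 1 le_rfl (by omega))
    h0 (hb d (by omega) le_rfl) h1 (h.not_adj (by omega) (by omega))
    (h.not_adj (by omega) (by omega)) (h.not_adj (by omega) (by omega))
    (h.not_adj (by omega) (by omega)))

/-- If `x` missed both centers, the triangle `s`, `c₁`, `c₂` with pendant vertices `x`, `b 0`, `b (d
+ 1)` would be a net. The net is the `†`-AW with two base vertices: shallow terminal `x`, center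
`s`, base `c₁`, `c₂`. -/
theorem adj_center_or (h : IsAW G s c₁ c₂ d b) (hG : IsReduced G) (hd : 3 < d)
    (hcc : c₁ ≠ c₂) (hx : G.Adj s x) (h₁ : x ≠ c₁) (h₂ : x ≠ c₂) :
    G.Adj x c₁ ∨ G.Adj x c₂ := by
  by_contra! hn
  obtain ⟨hc, hc0, hcd⟩ := h.centers.resolve_left hcc
  have h0 := h.not_adj_b_of_not_adj hG hx h.s_c₁ hn.1 h₁ (by omega) hc0
  have h1 := h.not_adj_b_of_not_adj hG hx h.s_c₂ hn.2 h₂ (by omega) hcd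
  have hnet : IsAW G x s s 2 (fun i => if i = 0 then b 0 else if i = 1 then c₁ else
      if i = 2 then c₂ else b (d + 1)) := by
    have e₁ := h.ne_b h.s_c₁
    have e₂ := h.ne_b h.s_c₂
    have e₃ := h.path.inj 0 (by omega) (d + 1) (by omega)
    have e₄ : ¬ G.Adj (b 0) (b (d + 1)) := h.not_adj (by omega) (by omega)
    refine ⟨⟨?_, ?_⟩, hx.symm, hx.symm, ?_, ?_, ?_, ?_, ?_, Or.inl rfl⟩
    · have f₁ := e₁ 0 (by omega)
      have f₂ := e₁ (d + 1) (by omega)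
      have f₃ := e₂ 0 (by omega)
      have f₄ := e₂ (d + 1) (by omega)
      have f₅ : b 0 ≠ b (d + 1) := fun e => by simpa using e₃ e
      intro i hi j hj
      interval_cases i <;> interval_cases j <;>
        simp [f₁, f₂, f₃, f₄, f₅, f₁.symm, f₂.symm, f₃.symm, f₄.symm, f₅.symm, hcc, hcc.symm]
    · have g₁ := h.c₁_last
      have g₂ := h.c₂_first
      have g₁' : ¬ G.Adj (b (d + 1)) c₁ := fun e => g₁ e.symm
      have g₂' : ¬ G.Adj (b 0) c₂ := fun e => g₂ e.symm
      have e₄' : ¬ G.Adj (b (d + 1)) (b 0) := fun e => e₄ e.symm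
      intro i hi j hj
      interval_cases i <;> interval_cases j <;>
        simp [g₁, g₂, g₁', g₂', e₄, e₄', hc, hc0, hcd, hc.symm, hc0.symm, hcd.symm]
    · intro i hi
      interval_cases i <;> simp [h0, h1, hn.1, hn.2]
    · intro i hi hi'
      interval_cases i <;> simp [h.s_c₁, h.s_c₂]
    · intro i hi hi'
      interval_cases i <;> simp [h.s_c₁, h.s_c₂]
    · simpa using h.s_b (d + 1) (by omega)
    · simpa using h.s_b 0 (by omega)
  have := hnet.three_lt hG (Or.inl le_rfl)
  omega

/-- If `x` missed `c₂`, squares and a pentagon through `c₂` would keep it away from the whole path.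
Then the path `x`, `s`, `c₂`, `b 1`, `b 0`, the vertex `c₁` adjacent to all of it, and `b (d + 1)`
attached to `c₂` form a whipping top. -/
theorem adj_right_of_adj_left (h : IsAW G s c₁ c₂ d b) (hG : IsReduced G) (hd : 3 < d)
    (hcc : c₁ ≠ c₂) (hx : G.Adj s x) (h₁ : G.Adj x c₁) (h₂ : x ≠ c₂) : G.Adj x c₂ := by
  by_contra hn
  obtain ⟨hc, hc0, hcd⟩ := h.centers.resolve_left hcc
  have hb : ∀ i, 1 ≤ i → i ≤ d → ¬ G.Adj x (b i) := fun i h1 h2 =>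
    h.not_adj_b_of_not_adj hG hx h.s_c₂ hn h₂ (by omega) (h.c₂_b i h1 h2)
  have hbd := h.not_adj_b_of_not_adj hG hx h.s_c₂ hn h₂ (by omega) hcd
  have hb1 := h.c₂_b 1 le_rfl (by omega)
  have h01 := h.adj_succ (i := 0) (by omega)
  have hx0 : ¬ G.Adj x (b 0) := fun e =>
    hG.1 (HasHole.of_pentagon e h01 hb1.symm h.s_c₂.symm hx (hb 1 le_rfl (by omega))
      (fun e => h.c₂_first e.symm) (fun e => h.s_b 1 (by omega) e.symm) (fun e => hn e.symm)
      (h.s_b 0 (by omega)))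
  exact hG.2 (HasSmallAW.of_whippingTop (a₀ := x) (a₁ := s) (a₂ := c₂) (a₃ := b 1) (a₄ := b 0)
    (a₅ := c₁) (a₆ := b (d + 1)) hx.symm hn (hb 1 le_rfl (by omega)) hx0 h₁ hbd h.s_c₂
    (h.s_b 1 (by omega)) (h.s_b 0 (by omega)) h.s_c₁ (h.s_b _ le_rfl) hb1 h.c₂_first hc.symm hcd
    h01.symm (h.c₁_b 1 le_rfl (by omega)).symm (h.not_adj (by omega) le_rfl) hc0.symm
    (h.not_adj (by omega) le_rfl) h.c₁_last)

/-- A neighbor of the shallow terminal of a long AW is adjacent to its centers. -/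
theorem adj_centers (h : IsAW G s c₁ c₂ d b) (hG : IsReduced G) (hd : 3 < d)
    (hx : G.Adj s x) (h₁ : x ≠ c₁) (h₂ : x ≠ c₂) : G.Adj x c₁ ∧ G.Adj x c₂ := by
  by_cases hcc : c₁ = c₂
  · subst hcc
    exact ⟨h.adj_center hG hd hx h₁, h.adj_center hG hd hx h₁⟩
  rcases h.adj_center_or hG hd hcc hx h₁ h₂ with e | e
  · exact ⟨e, h.adj_right_of_adj_left hG hd hcc hx e h₂⟩
  · exact ⟨h.reverse.adj_right_of_adj_left hG hd (Ne.symm hcc) hx e h₁, e⟩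

/-- A neighbor of the shallow terminal without neighbors on the path can replace it. -/
theorem replace_shallow (h : IsAW G s c₁ c₂ d b) (h₁ : G.Adj x c₁) (h₂ : G.Adj x c₂)
    (hx : ∀ i ≤ d + 1, ¬ G.Adj x (b i)) : IsAW G x c₁ c₂ d b :=
  { h with s_c₁ := h₁, s_c₂ := h₂, s_b := hx }

/-- A neighbor of the shallow terminal with a neighbor `b i` and a later nonneighbor in the base
yields a shorter AW. -/
theorem exists_shorter_of_lt (h : IsAW G s c₁ c₂ d b) (hG : IsReduced G) (hd : 3 < d)
    (hx : G.Adj s x) (h₂ : G.Adj x c₂) {i m : ℕ} (him : i < m) (hm : m ≤ d)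
    (hi : G.Adj x (b i)) (hxm : ¬ G.Adj x (b m)) :
    -- The neighbours of `x` on the path will be exactly `b p, …, b (p + r)`, where `p + r + 1 ≤ m ≤
    -- d`.
    ∃ c₁' c₂' d' b', IsAW G s c₁' c₂' d' b' ∧ 3 < d' ∧ d' < d := by
  classical
  have hcons : ∀ {i j k : ℕ}, i ≤ k → k ≤ j → j ≤ d + 1 → G.Adj x (b i) → G.Adj x (b j) →
      G.Adj x (b k) := fun hik hkj hj => h.path.adj_of_adj_of_adj hG.1 (h.ne_b hx) hik hkj hj
  have e₁ : ∃ p, G.Adj x (b p) := ⟨i, hi⟩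
  obtain ⟨p, hp, hpmin⟩ : ∃ p, G.Adj x (b p) ∧ ∀ j < p, ¬ G.Adj x (b j) :=
    ⟨Nat.find e₁, Nat.find_spec e₁, fun j hj => Nat.find_min e₁ hj⟩
  have hpi : p ≤ i := by
    by_contra hlt
    exact hpmin i (by omega) hi
  have e₂ : ∃ r, ¬ G.Adj x (b (p + r + 1)) :=
    ⟨m - p - 1, by rwa [show p + (m - p - 1) + 1 = m by omega]⟩
  obtain ⟨r, hr, hrmin⟩ : ∃ r, ¬ G.Adj x (b (p + r + 1)) ∧ ∀ t < r, G.Adj x (b (p + t + 1)) :=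
    ⟨Nat.find e₂, Nat.find_spec e₂, fun j hj => not_not.1 (Nat.find_min e₂ hj)⟩
  have hrm : p + r + 1 ≤ m := by
    by_contra hlt
    refine hxm ?_
    have := hrmin (m - p - 1) (by omega)
    rwa [show p + (m - p - 1) + 1 = m by omega] at this
  have hrun : ∀ t ≤ r, G.Adj x (b (p + t)) := by
    intro t ht
    rcases Nat.eq_zero_or_pos t with rfl | h0
    · exact hp
    · have := hrmin (t - 1) (by omega)
      rwa [show p + (t - 1) + 1 = p + t by omega] at this
  have hafter : ∀ j, p + r + 1 ≤ j → j ≤ d + 1 → ¬ G.Adj x (b j) := fun j h1 h2 e =>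
    hr (hcons (by omega) h1 h2 hp e)
  rcases Nat.eq_zero_or_pos p with rfl | hp0
  · simp only [Nat.zero_add] at *
    rcases Nat.eq_zero_or_pos r with rfl | hr0
    -- Only `b 0` is adjacent to `x`: the square `x`, `b 0`, `b 1`, `c₂`.
    · refine absurd (HasHole.of_square hp (h.adj_succ (i := 0) (by omega))
        (h.c₂_b 1 le_rfl (by omega)).symm h₂.symm hr (fun e => h.c₂_first e.symm)
        (h.ne_b hx 1 (by omega)) (h.ne_b h.s_c₂ 0 (by omega)).symm) hG.1
    -- The interval starts at `b 0` and has at least two vertices: a `‡`-AW with centers `x`, `c₂`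
    -- and base `b 1, …, b r`.
    · have hAW : IsAW G s x c₂ r b :=
        { path := by simpa using h.path.segment (p := 0) (l := r + 1) (by omega)
          s_c₁ := hx
          s_c₂ := h.s_c₂
          s_b := fun i hi => h.s_b i (by omega)
          c₁_b := fun i _ h2 => hrun i h2
          c₂_b := fun i h1 h2 => h.c₂_b i h1 (by omega)
          c₁_last := hr
          c₂_first := h.c₂_first
          centers := Or.inr ⟨h₂, hp, h.c₂_b _ (by omega) (by omega)⟩ }
      exact ⟨_, _, _, _, hAW, hAW.three_lt hG (Or.inr ⟨hr0, h₂.ne⟩), by omega⟩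
  · rcases Nat.eq_zero_or_pos r with rfl | hr0
    · exfalso
      simp only [Nat.add_zero] at *
      -- A single neighbour `b p` in the base. For `p = 1` there is a whipping top on the path `s`,
      -- `x`, `b 1`, `b 2`, `b 3`, with `c₂` adjacent to all of it and `b 0` attached to `b 1`. For
      -- `p ≥ 2` there is room for two path vertices on either side of `b p`, which give a long claw
      -- with third leg `x s`.
      by_cases hp1 : p = 1
      · subst hp1
        have g : ∀ j, 1 ≤ j → j ≤ 3 → G.Adj (b j) c₂ := fun j h1 h2 =>
          (h.c₂_b j h1 (by omega)).symm
        exact hG.2 (HasSmallAW.of_whippingTop (a₀ := s) (a₁ := x) (a₂ := b 1) (a₃ := b 2)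
          (a₄ := b 3) (a₅ := c₂) (a₆ := b 0) hx (h.s_b _ (by omega)) (h.s_b _ (by omega))
          (h.s_b _ (by omega)) h.s_c₂ (h.s_b _ (by omega)) hp hr (hafter 3 (by omega) (by omega))
          h₂ (hpmin 0 (by omega)) (h.adj_succ (by omega)) (h.not_adj (by omega) (by omega))
          (g 1 (by omega) (by omega)) (h.adj_succ (i := 0) (by omega)).symm
          (h.adj_succ (by omega)) (g 2 (by omega) (by omega))
          (fun e => h.not_adj (i := 0) (j := 2) (by omega) (by omega) e.symm)
          (g 3 (by omega) (by omega))
          (fun e => h.not_adj (i := 0) (j := 3) (by omega) (by omega) e.symm) h.c₂_first)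
      · obtain ⟨q, rfl⟩ : ∃ q, p = q + 2 := ⟨p - 2, by omega⟩
        have nb : ∀ {i j : ℕ}, i ≤ d + 1 → j ≤ d + 1 → i + 1 ≠ j → j + 1 ≠ i →
            ¬ G.Adj (b i) (b j) := fun hi hj h1 h2 e => by
          have := (h.path.adj _ hi _ hj).1 e
          omega
        exact hG.2 (HasSmallAW.of_longClaw (a₀ := b (q + 2)) (a₁ := x) (a₂ := s)
          (a₃ := b (q + 1)) (a₄ := b q) (a₅ := b (q + 3)) (a₆ := b (q + 4)) hp.symm hx.symm
          (h.adj_succ (by omega)).symm (h.adj_succ (by omega)).symm (h.adj_succ (by omega))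
          (h.adj_succ (by omega)) (fun e => h.s_b _ (by omega) e.symm)
          (nb (by omega) (by omega) (by omega) (by omega))
          (nb (by omega) (by omega) (by omega) (by omega)) (hpmin _ (by omega))
          (hpmin _ (by omega)) (hafter _ (by omega) (by omega)) (hafter _ (by omega) (by omega))
          (h.s_b _ (by omega)) (h.s_b _ (by omega)) (h.s_b _ (by omega)) (h.s_b _ (by omega))
          (nb (by omega) (by omega) (by omega) (by omega))
          (nb (by omega) (by omega) (by omega) (by omega))
          (nb (by omega) (by omega) (by omega) (by omega))
          (nb (by omega) (by omega) (by omega) (by omega)))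
    -- The interval starts after `b 0` and has at least two vertices: a `†`-AW with center `x`,
    -- whose base is the interval and whose base terminals are the path vertices next to it.
    · obtain ⟨q, rfl⟩ : ∃ q, p = q + 1 := ⟨p - 1, by omega⟩
      have hrun' : ∀ i, 1 ≤ i → i ≤ r + 1 → G.Adj x (b (q + i)) := fun i h1 h2 => by
        have := hrun (i - 1) (by omega)
        rwa [show q + 1 + (i - 1) = q + i by omega] at this
      have hAW : IsAW G s x x (r + 1) (fun i => b (q + i)) :=
        { path := h.path.segment (by omega)
          s_c₁ := hx
          s_c₂ := hx
          s_b := fun i hi => h.s_b _ (by omega)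
          c₁_b := hrun'
          c₂_b := hrun'
          c₁_last := by rwa [show q + (r + 1 + 1) = q + 1 + r + 1 by omega]
          c₂_first := hpmin _ (by omega)
          centers := Or.inl rfl }
      exact ⟨_, _, _, _, hAW, hAW.three_lt hG (Or.inl (by omega)), by omega⟩

/-- A long AW with the fewest base vertices among those with the same shallow terminal `s` has its
base completely connected to the neighbors of `s` that are not shallow terminals. -/
theorem adj_base_of_minimal (h : IsAW G s c₁ c₂ d b) (hG : IsReduced G) (hd : 3 < d)
    (hmin : ∀ c₁' c₂' d' b', IsAW G s c₁' c₂' d' b' → 3 < d' → d ≤ d')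
    (hx : G.Adj s x) (hST : x ∉ ST G) {m : ℕ} (h1 : 1 ≤ m) (hm : m ≤ d) : G.Adj x (b m) := by
  by_cases e₁ : x = c₁
  · exact e₁ ▸ h.c₁_b m h1 hm
  by_cases e₂ : x = c₂
  · exact e₂ ▸ h.c₂_b m h1 hm
  obtain ⟨h₁, h₂⟩ := h.adj_centers hG hd hx e₁ e₂
  by_contra hxm
  obtain ⟨i, hi, hxi⟩ : ∃ i ≤ d + 1, G.Adj x (b i) := by
    by_contra! hno
    obtain ⟨W, -, hW, -⟩ := (h.replace_shallow h₁ h₂ hno).exists_longAW hd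
    exact hST ⟨W, hW⟩
  obtain ⟨c₁', c₂', d', b', hAW, h3, hlt⟩ :
      ∃ c₁' c₂' d' b', IsAW G s c₁' c₂' d' b' ∧ 3 < d' ∧ d' < d := by
    rcases lt_trichotomy i m with hlt | rfl | hlt
    · exact h.exists_shorter_of_lt hG hd hx h₂ hlt hm hxi hxm
    · exact absurd hxi hxm
    -- Reversal makes `c₁` the second center, hence `h₁` in place of `h₂`.
    · exact h.reverse.exists_shorter_of_lt hG hd hx h₁ (i := d + 1 - i) (m := d + 1 - m)
        (by omega) (by omega) (by rwa [Nat.sub_sub_self hi]) (by rwa [Nat.sub_sub_self (by omega)])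
  have := hmin _ _ _ _ hAW h3
  omega

/-- Two ends of the path of a long `†`-AW have no common neighbor among the possible base
vertices. -/
theorem not_adj_ends (h : IsAW G s c₁ c₁ d b) (hG : IsReduced G) (hd : 3 < d) {a : V}
    (hca : G.Adj c₁ a) (hsa : ¬ G.Adj s a) (h0 : G.Adj a (b 0)) : ¬ G.Adj a (b (d + 1)) := by
  intro h1
  by_cases hne : ∃ i ≤ d + 1, a = b i
  · obtain ⟨i, hi, rfl⟩ := hne
    have := (h.path.adj i hi 0 (by omega)).1 h0
    have := (h.path.adj i hi _ le_rfl).1 h1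
    omega
  · push Not at hne
    have hall : ∀ i ≤ d + 1, G.Adj a (b i) := fun i hi =>
      h.path.adj_of_adj_of_adj hG.1 hne (Nat.zero_le i) hi le_rfl h0 h1
    have hb1 := h.c₁_b 1 le_rfl (by omega)
    have hbd := h.c₁_b d (by omega) le_rfl
    -- A common neighbour `a` of the ends sees the whole path. Going through `c₁` shortens the path
    -- to `b 0`, `b 1`, `c₁`, `b d`, `b (d + 1)`, all adjacent to `a`, with `s` attached to `c₁`.
    exact hG.2 (HasSmallAW.of_whippingTop (a₀ := b 0) (a₁ := b 1) (a₂ := c₁) (a₃ := b d)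
      (a₄ := b (d + 1)) (a₅ := a) (a₆ := s) (h.adj_succ (i := 0) (by omega))
      (fun e => h.c₂_first e.symm) (h.not_adj (by omega) (by omega))
      (h.not_adj (by omega) (by omega)) h0.symm (fun e => h.s_b _ (by omega) e.symm) hb1.symm
      (h.not_adj (by omega) (by omega)) (h.not_adj (by omega) (by omega))
      (hall 1 (by omega)).symm (fun e => h.s_b _ (by omega) e.symm) hbd h.c₁_last hca
      h.s_c₁.symm (h.adj_succ le_rfl) (hall d (by omega)).symm
      (fun e => h.s_b _ (by omega) e.symm) h1.symm (fun e => h.s_b _ (by omega) e.symm)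
      (fun e => hsa e.symm))

end IsAW

/-- Shared by the existence statement and the program: minimizing the base suffices, so membership
in `ST G` need never be decided. -/
theorem isGoodAW_of_minimal (hG : IsReduced G) (W : LongAW G)
    (hmin : ∀ W' : LongAW G, W'.shallowTerminal = W.shallowTerminal → W.d ≤ W'.d) :
    IsGoodAW G W.shallowTerminal W := by
  obtain ⟨hd, b, hb, hpath⟩ := W.exists_isAW
  refine ⟨rfl, ?_⟩
  rintro v ⟨i, h1, h2, rfl⟩ x ⟨hx, hST⟩
  rw [hpath]
  refine (hb.adj_base_of_minimal hG hd ?_ hx hST h1 h2).symm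
  intro c₁' c₂' d' b' h' hd'
  obtain ⟨W', hW', hs, -⟩ := h'.exists_longAW hd'
  exact hW' ▸ hmin W' hs

theorem exists_isGoodAW (hG : IsReduced G) (hs : s ∈ ST G) : ∃ W : LongAW G, IsGoodAW G s W := by
  classical
  have hex : ∃ d, ∃ W : LongAW G, W.shallowTerminal = s ∧ W.d = d := by
    obtain ⟨W, hW⟩ := hs
    exact ⟨W.d, W, hW, rfl⟩
  obtain ⟨W, hW, hd⟩ := Nat.find_spec hex
  refine ⟨W, hW ▸ isGoodAW_of_minimal hG W fun W' hW' => ?_⟩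
  rw [hd]
  exact Nat.find_min' hex ⟨W', hW'.trans hW, rfl⟩

end IntervalCompletion

namespace IntervalCompletion

/-! ### Programs with counting loops -/

/-- The state `σ` with register `x` set to `v`. -/
def State.setReg (σ : State) (x v : ℕ) : State := ⟨Function.update σ.reg x v, σ.arr⟩

/-- The state `σ` with cell `i` of array `a` set to `v`. -/
def State.setCell (σ : State) (a i v : ℕ) : State :=
  ⟨σ.reg, Function.update σ.arr a (Function.update (σ.arr a) i v)⟩

@[simp] theorem State.setReg_reg (σ : State) (x v : ℕ) :
    (σ.setReg x v).reg = Function.update σ.reg x v := rfl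

@[simp] theorem State.setReg_arr (σ : State) (x v : ℕ) : (σ.setReg x v).arr = σ.arr := rfl

@[simp] theorem State.setCell_reg (σ : State) (a i v : ℕ) : (σ.setCell a i v).reg = σ.reg := rfl

@[simp] theorem State.setCell_arr (σ : State) (a i v : ℕ) :
    (σ.setCell a i v).arr = Function.update σ.arr a (Function.update (σ.arr a) i v) := rfl

namespace Expr

variable (e f : Expr) (σ : State)

/-- Nonzero if and only if `e` and `f` are. -/
def and : Expr := .eq (.add (.eq e (.const 0)) (.eq f (.const 0))) (.const 0)

/-- Nonzero if and only if `e` or `f` is. -/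
def or : Expr := .add e f

/-- Nonzero if and only if `e` is zero. -/
def not : Expr := .eq e (.const 0)

theorem lt_ne_zero : (Expr.lt e f).eval σ ≠ 0 ↔ e.eval σ < f.eval σ := by
  change (if e.eval σ < f.eval σ then 1 else 0) ≠ 0 ↔ _
  split_ifs with h <;> simp [h]

theorem eq_ne_zero : (Expr.eq e f).eval σ ≠ 0 ↔ e.eval σ = f.eval σ := by
  change (if e.eval σ = f.eval σ then 1 else 0) ≠ 0 ↔ _
  split_ifs with h <;> simp [h]

theorem not_ne_zero : e.not.eval σ ≠ 0 ↔ ¬ e.eval σ ≠ 0 := by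
  rw [not, eq_ne_zero, not_not]
  rfl

theorem or_ne_zero : (e.or f).eval σ ≠ 0 ↔ e.eval σ ≠ 0 ∨ f.eval σ ≠ 0 := by
  change e.eval σ + f.eval σ ≠ 0 ↔ _
  omega

theorem and_ne_zero : (e.and f).eval σ ≠ 0 ↔ e.eval σ ≠ 0 ∧ f.eval σ ≠ 0 := by
  have h := not_ne_zero e σ
  have h' := not_ne_zero f σ
  rw [and, eq_ne_zero]
  change e.not.eval σ + f.not.eval σ = 0 ↔ _
  omega

end Expr

/-- Programs whose loops run a register through `0, …, n - 1`, where `n` is the content of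
register `0`. -/
inductive ForProg : Type
  | assign (x : ℕ) (e : Expr) : ForProg
  | write (a : ℕ) (i e : Expr) : ForProg
  | seq (P Q : ForProg) : ForProg
  | when (e : Expr) (P : ForProg) : ForProg
  | forLoop (x : ℕ) (P : ForProg) : ForProg

namespace ForProg

/-- The translation into the machine language. -/
def compile : ForProg → Prog
  | assign x e => .assign x e
  | write a i e => .write a i e
  | seq P Q => .seq P.compile Q.compile
  | when e P => .branch e P.compile .skip
  | forLoop x P => .seq (.assign x (.const 0)) (.loop (.lt (.reg x) (.reg 0))
      (.seq P.compile (.assign x (.add (.reg x) (.const 1)))))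

/-- The final state. -/
def run : ForProg → State → State
  | assign x e, σ => σ.setReg x (e.eval σ)
  | write a i e, σ => σ.setCell a (i.eval σ) (e.eval σ)
  | seq P Q, σ => Q.run (P.run σ)
  | when e P, σ => if e.eval σ ≠ 0 then P.run σ else σ
  | forLoop x P, σ =>
      (fun τ => (P.run τ).setReg x ((P.run τ).reg x + 1))^[σ.reg 0] (σ.setReg x 0)

/-- The registers that the program may change. -/
def regs : ForProg → List ℕ
  | assign x _ => [x]
  | write _ _ _ => []
  | seq P Q => P.regs ++ Q.regs
  | when _ P => P.regs
  | forLoop x P => x :: P.regs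

/-- The arrays that the program may change. -/
def arrs : ForProg → List ℕ
  | assign _ _ => []
  | write a _ _ => [a]
  | seq P Q => P.arrs ++ Q.arrs
  | when _ P => P.arrs
  | forLoop _ P => P.arrs

/-- The body of a loop does not change its loop variable, and register `0` is kept. -/
def Wf : ForProg → Prop
  | assign _ _ => True
  | write _ _ _ => True
  | seq P Q => P.Wf ∧ Q.Wf ∧ 0 ∉ P.regs
  | when _ P => P.Wf
  | forLoop x P => P.Wf ∧ x ≠ 0 ∧ x ∉ P.regs ∧ 0 ∉ P.regs

instance decidableWf : DecidablePred Wf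
  | assign _ _ => .isTrue trivial
  | write _ _ _ => .isTrue trivial
  | seq P Q => @instDecidableAnd _ _ (decidableWf P)
      (@instDecidableAnd _ _ (decidableWf Q) inferInstance)
  | when _ P => decidableWf P
  | forLoop _ P => @instDecidableAnd _ _ (decidableWf P) inferInstance

open Polynomial in
/-- A bound for the number of steps, in terms of the content of register `0`. -/
noncomputable def time : ForProg → Polynomial ℕ
  | assign _ e => C (e.cost + 1)
  | write _ i e => C (i.cost + e.cost + 1)
  | seq P Q => P.time + Q.time
  | when e P => C (e.cost + 2) + P.time
  | forLoop _ P => C 6 + X * (P.time + C 8)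

/-- `τ` arises from `σ` by changing only registers in `rs` and arrays in `as`. -/
def Agree (rs as : List ℕ) (σ τ : State) : Prop :=
  (∀ x, x ∉ rs → τ.reg x = σ.reg x) ∧ ∀ a, a ∉ as → τ.arr a = σ.arr a

theorem iterate_agree {rs as : List ℕ} {f : State → State} (hf : ∀ τ, Agree rs as τ (f τ)) (n : ℕ)
    (σ : State) : Agree rs as σ (f^[n] σ) := by
  induction n with
  | zero => exact ⟨fun _ _ => rfl, fun _ _ => rfl⟩
  | succ n ih =>
    rw [Function.iterate_succ_apply']
    exact ⟨fun x hx => ((hf _).1 x hx).trans (ih.1 x hx),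
      fun a ha => ((hf _).2 a ha).trans (ih.2 a ha)⟩

theorem run_agree (P : ForProg) (σ : State) : Agree P.regs P.arrs σ (P.run σ) := by
  induction P generalizing σ with
  | assign x e =>
    refine ⟨fun y hy => ?_, fun _ _ => rfl⟩
    simp only [regs, List.mem_singleton] at hy
    simp [run, hy]
  | write a i e =>
    refine ⟨fun _ _ => rfl, fun y hy => ?_⟩
    simp only [arrs, List.mem_singleton] at hy
    simp [run, hy]
  | seq P Q hP hQ =>
    refine ⟨fun x hx => ?_, fun a ha => ?_⟩
    · simp only [regs, List.mem_append, not_or] at hx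
      exact ((hQ _).1 x hx.2).trans ((hP _).1 x hx.1)
    · simp only [arrs, List.mem_append, not_or] at ha
      exact ((hQ _).2 a ha.2).trans ((hP _).2 a ha.1)
  | when e P hP =>
    rw [run]
    split_ifs
    · exact hP σ
    · exact ⟨fun _ _ => rfl, fun _ _ => rfl⟩
  | forLoop x P hP =>
    have h := iterate_agree (rs := x :: P.regs) (as := P.arrs)
      (f := fun τ => (P.run τ).setReg x ((P.run τ).reg x + 1))
      (fun τ => ⟨fun y hy => ?_, fun a ha => ?_⟩) (σ.reg 0) (σ.setReg x 0)
    · refine ⟨fun y hy => (h.1 y hy).trans ?_, fun a ha => h.2 a ha⟩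
      simp only [regs, List.mem_cons, not_or] at hy
      simp [hy.1]
    · simp only [List.mem_cons, not_or] at hy
      simpa [hy.1] using (hP τ).1 y hy.2
    · exact (hP τ).2 a ha

/-- The loop rule: an invariant `I i` of the states before the `i`-th round. -/
theorem forLoop_induction {x : ℕ} {P : ForProg} (hx : x ∉ P.regs) (σ : State)
    (I : ℕ → State → Prop) (h0 : I 0 (σ.setReg x 0))
    (hstep : ∀ i < σ.reg 0, ∀ τ, I i τ → τ.reg x = i →
      Agree (x :: P.regs) P.arrs σ τ → I (i + 1) ((P.run τ).setReg x (i + 1))) :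
    I (σ.reg 0) ((forLoop x P).run σ) := by
  rw [run]
  have key : ∀ i ≤ σ.reg 0,
      I i ((fun τ => (P.run τ).setReg x ((P.run τ).reg x + 1))^[i] (σ.setReg x 0)) ∧
      ((fun τ => (P.run τ).setReg x ((P.run τ).reg x + 1))^[i] (σ.setReg x 0)).reg x = i ∧
      Agree (x :: P.regs) P.arrs σ
        ((fun τ => (P.run τ).setReg x ((P.run τ).reg x + 1))^[i] (σ.setReg x 0)) := by
    intro i
    induction i with
    | zero =>
      intro _
      refine ⟨h0, by simp, fun y hy => ?_, fun _ _ => rfl⟩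
      simp only [List.mem_cons, not_or] at hy
      simp [hy.1]
    | succ i ih =>
      intro hi
      obtain ⟨h1, h2, h3⟩ := ih (by omega)
      rw [Function.iterate_succ_apply']
      generalize (fun τ => (P.run τ).setReg x ((P.run τ).reg x + 1))^[i] (σ.setReg x 0) = τ at *
      have hreg : (P.run τ).reg x = i := ((run_agree P τ).1 x hx).trans h2
      simp only [hreg]
      refine ⟨hstep i (by omega) τ h1 h2 h3, by simp, fun y hy => ?_, fun a ha => ?_⟩
      · rw [← h3.1 y hy]
        simp only [List.mem_cons, not_or] at hy
        simpa [hy.1] using (run_agree P τ).1 y hy.2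
      · rw [← h3.2 a ha]
        exact (run_agree P τ).2 a ha
  exact (key _ le_rfl).1

/-- Here `k` counts the rounds still to come. A test of the loop condition takes 4 steps and the
increment takes 4, so a round takes at most `T + 8`; the last, failing test accounts for the
remaining 4. -/
theorem exec_loop {x : ℕ} {P : Prog} {f : State → State} {n T : ℕ} (hx : x ≠ 0)
    (hf : ∀ σ, (f σ).reg x = σ.reg x ∧ (f σ).reg 0 = σ.reg 0)
    (hP : ∀ σ, σ.reg 0 = n → ∃ t ≤ T, Exec P σ t (f σ)) (k : ℕ) (σ : State) (hσ : σ.reg 0 = n)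
    (hk : σ.reg x + k = n) :
    ∃ t ≤ 4 + k * (T + 8), Exec (.loop (.lt (.reg x) (.reg 0))
      (.seq P (.assign x (.add (.reg x) (.const 1))))) σ t
      ((fun τ => (f τ).setReg x ((f τ).reg x + 1))^[k] σ) := by
  induction k generalizing σ with
  | zero =>
    exact ⟨_, by simp [Expr.cost], Exec.loop_done (not_not.1 (mt (Expr.lt_ne_zero _ _ _).1
      (by simp only [Expr.eval]; omega)))⟩
  | succ k ih =>
    obtain ⟨t, ht, hexec⟩ := hP σ hσ
    obtain ⟨u, hu, hloop⟩ := ih ((f σ).setReg x ((f σ).reg x + 1))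
      (by simpa [hx.symm] using (hf σ).2.trans hσ) (by simp [(hf σ).1]; omega)
    refine ⟨_, ?_, Exec.loop_step ((Expr.lt_ne_zero _ _ _).2 (by simp only [Expr.eval]; omega))
      (Exec.seq hexec (Exec.assign _ _ _)) hloop⟩
    simp only [Expr.cost]
    nlinarith

/-- Well-formedness keeps register `0` fixed wherever a later bound refers to it, so every loop has
the same number of rounds and nesting multiplies polynomials in that number. -/
theorem exec_compile (P : ForProg) (hP : P.Wf) (σ : State) :
    ∃ t ≤ P.time.eval (σ.reg 0), Exec P.compile σ t (P.run σ) := by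
  induction P generalizing σ with
  | assign x e => exact ⟨_, by simp [time], Exec.assign σ x e⟩
  | write a i e => exact ⟨_, by simp [time], Exec.write σ a i e⟩
  | seq P Q ihP ihQ =>
    obtain ⟨hwP, hwQ, h0⟩ := hP
    obtain ⟨t, ht, h⟩ := ihP hwP σ
    obtain ⟨u, hu, h'⟩ := ihQ hwQ (P.run σ)
    rw [(run_agree P σ).1 0 h0] at hu
    exact ⟨_, by simp only [time, Polynomial.eval_add]; omega, Exec.seq h h'⟩
  | when e P ih =>
    obtain ⟨t, ht, h⟩ := ih hP σ
    by_cases he : e.eval σ = 0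
    · refine ⟨_, ?_, by simpa [run, compile, he] using
        Exec.branch_false (P := P.compile) he (Exec.skip σ)⟩
      simp [time]; omega
    · refine ⟨_, ?_, by simpa [run, compile, he] using Exec.branch_true (Q := .skip) he h⟩
      simp [time]; omega
  | forLoop x P ih =>
    obtain ⟨hwf, hx, hxP, h0P⟩ := hP
    obtain ⟨t, ht, h⟩ := exec_loop (P := P.compile) (f := P.run) (n := σ.reg 0) hx
      (fun τ => ⟨(run_agree P τ).1 x hxP, (run_agree P τ).1 0 h0P⟩)
      (fun τ hτ => hτ ▸ ih hwf τ) (σ.reg 0) (σ.setReg x 0) (by simp [hx.symm]) (by simp)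
    refine ⟨_, ?_, Exec.seq (Exec.assign σ x (.const 0)) h⟩
    simp [time, Expr.cost]; omega

end ForProg

end IntervalCompletion

namespace IntervalCompletion

universe u

variable {V : Type u} {G : SimpleGraph V}

/-! ### Distances inside a set of vertices -/

/-- There is a walk with `k` edges from the given vertex to `w` whose vertices other than the last
one lie in `B`. -/
def Reach (G : SimpleGraph V) (B : V → Prop) (w : V) : ℕ → V → Prop
  | 0, v => v = w
  | k + 1, v => B v ∧ ∃ v', G.Adj v v' ∧ Reach G B w k v'

/-- `D` is the distance to `w` inside `B`, truncated at `N`. -/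
structure IsDist (G : SimpleGraph V) (B : V → Prop) (w : V) (N : ℕ) (D : V → ℕ) : Prop where
  sound : ∀ v, D v < N → Reach G B w (D v) v
  complete : ∀ k v, Reach G B w k v → D v ≤ k

/-- The vertices that may lie on the path of an AW with shallow terminal `s`, centers `c₁`, `c₂` and
base terminals `u`, `w`. -/
def PathVertex (G : SimpleGraph V) (s c₁ c₂ u w v : V) : Prop :=
  v = u ∨ v = w ∨ G.Adj c₁ v ∧ G.Adj c₂ v ∧ ¬ G.Adj s v ∧ v ≠ s

/-- The conditions on the centers and base terminals of an AW that do not involve its base. -/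
structure IsFrame (G : SimpleGraph V) (s c₁ c₂ u w : V) : Prop where
  s_c₁ : G.Adj s c₁
  s_c₂ : G.Adj s c₂
  s_u : ¬ G.Adj s u
  s_w : ¬ G.Adj s w
  c₁_w : ¬ G.Adj c₁ w
  c₂_u : ¬ G.Adj c₂ u
  centers : c₁ = c₂ ∨ G.Adj c₁ c₂ ∧ G.Adj c₁ u ∧ G.Adj c₂ w

namespace IsDist

variable {B : V → Prop} {w : V} {N : ℕ} {D : V → ℕ}

theorem apply_target (h : IsDist G B w N D) : D w = 0 := Nat.le_zero.1 (h.complete 0 w rfl)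

theorem eq_target (h : IsDist G B w N D) (hN : 0 < N) {v : V} (hv : D v = 0) : v = w := by
  have := h.sound v (by omega)
  rwa [hv] at this

theorem mem (h : IsDist G B w N D) {v : V} (h0 : D v ≠ 0) (hN : D v < N) : B v := by
  have := h.sound v hN
  obtain ⟨k, hk⟩ := Nat.exists_eq_succ_of_ne_zero h0
  rw [hk] at this
  exact this.1

theorem le_succ (h : IsDist G B w N D) {v v' : V} (hv : B v) (hadj : G.Adj v v') (hN : D v' < N) :
    D v ≤ D v' + 1 := h.complete _ _ ⟨hv, v', hadj, h.sound v' hN⟩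

theorem exists_next (h : IsDist G B w N D) {v : V} (h0 : D v ≠ 0) (hN : D v < N) :
    ∃ v', G.Adj v v' ∧ D v' + 1 = D v := by
  have hr := h.sound v hN
  obtain ⟨k, hk⟩ := Nat.exists_eq_succ_of_ne_zero h0
  rw [hk] at hr
  obtain ⟨hB, v', hadj, hr'⟩ := hr
  have h1 := h.complete _ _ hr'
  have h2 := h.le_succ hB hadj (by omega)
  exact ⟨v', hadj, by omega⟩

theorem exists_descent (h : IsDist G B w N D) {u : V} (hu : D u < N) :
    ∃ p : ℕ → V, p 0 = u ∧ ∀ k < D u, G.Adj (p k) (p (k + 1)) ∧ D (p (k + 1)) + 1 = D (p k) := by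
  classical
  have hnext : ∀ v, ∃ v', D v ≠ 0 → D v < N → G.Adj v v' ∧ D v' + 1 = D v := by
    intro v
    by_cases h0 : D v = 0
    · exact ⟨v, fun h => absurd h0 h⟩
    by_cases hN : D v < N
    · obtain ⟨v', h'⟩ := h.exists_next h0 hN
      exact ⟨v', fun _ _ => h'⟩
    · exact ⟨v, fun _ h => absurd h hN⟩
  choose f hf using hnext
  have hD : ∀ k ≤ D u, D (f^[k] u) = D u - k := by
    intro k
    induction k with
    | zero => simp
    | succ k ih =>
      intro hk
      have e := ih (by omega)
      have := (hf (f^[k] u) (by omega) (by omega)).2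
      rw [Function.iterate_succ_apply']
      omega
  refine ⟨fun k => f^[k] u, rfl, fun k hk => ?_⟩
  have e := hD k (by omega)
  simp only [Function.iterate_succ_apply']
  exact hf _ (by omega) (by omega)

variable {s c₁ c₂ u : V} {p : ℕ → V}

/-- A descent along the distances is the path of an AW. -/
theorem isAW (h : IsDist G (PathVertex G s c₁ c₂ u w) w N D) (hF : IsFrame G s c₁ c₂ u w)
    {d : ℕ} (hd : D u = d + 1) (hN : D u < N) (hp0 : p 0 = u)
    (hp : ∀ k < D u, G.Adj (p k) (p (k + 1)) ∧ D (p (k + 1)) + 1 = D (p k)) :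
    IsAW G s c₁ c₂ d p ∧ p (d + 1) = w := by
  have hD : ∀ k ≤ d + 1, D (p k) = d + 1 - k := by
    intro k
    induction k with
    | zero => intro _; rw [hp0, hd]; rfl
    | succ k ih =>
      intro hk
      have := ih (by omega)
      have := (hp k (by omega)).2
      omega
  have hw : p (d + 1) = w := h.eq_target (by omega) (by rw [hD _ le_rfl]; omega)
  -- Inner vertices have distance strictly between `0` and `D u`, so they are neither `w` nor `u`,
  -- and only the third alternative of `PathVertex` remains.
  have hin : ∀ k, 1 ≤ k → k ≤ d →
      G.Adj c₁ (p k) ∧ G.Adj c₂ (p k) ∧ ¬ G.Adj s (p k) ∧ p k ≠ s := by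
    intro k h1 h2
    have e := hD k (by omega)
    rcases h.mem (v := p k) (by omega) (by omega) with e' | e' | e'
    · rw [e'] at e; omega
    · rw [e', h.apply_target] at e; omega
    · exact e'
  have hB : ∀ k ≤ d + 1, PathVertex G s c₁ c₂ u w (p k) := by
    intro k hk
    by_cases e : k = d + 1
    · exact Or.inr (Or.inl (e ▸ hw))
    · have := hD k hk
      exact h.mem (by omega) (by omega)
  refine ⟨⟨⟨?_, ?_⟩, hF.s_c₁, hF.s_c₂, ?_, fun i h1 h2 => (hin i h1 h2).1,
    fun i h1 h2 => (hin i h1 h2).2.1, hw ▸ hF.c₁_w, hp0 ▸ hF.c₂_u, ?_⟩, hw⟩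
  · intro i hi j hj e
    have e₁ := hD i hi
    have e₂ := hD j hj
    rw [e] at e₁
    omega
  · intro i hi j hj
    have e₁ := hD i hi
    have e₂ := hD j hj
    constructor
    -- Distances of adjacent vertices differ by at most one, and along the descent the distance
    -- determines the index; hence there are no chords.
    · intro hadj
      have l₁ := h.le_succ (hB i hi) hadj (by omega)
      have l₂ := h.le_succ (hB j hj) hadj.symm (by omega)
      have : i ≠ j := by rintro rfl; exact hadj.ne rfl
      omega
    · rintro (rfl | rfl)
      · exact (hp i (by omega)).1
      · exact (hp j (by omega)).1.symm
  · intro i hi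
    by_cases h0 : i = 0
    · rw [h0, hp0]; exact hF.s_u
    by_cases h1 : i = d + 1
    · rw [h1, hw]; exact hF.s_w
    exact (hin i (by omega) (by omega)).2.2.1
  · rw [hp0, hw]; exact hF.centers

end IsDist

namespace IsAW

variable {s c₁ c₂ : V} {d : ℕ} {b : ℕ → V}

theorem isFrame (h : IsAW G s c₁ c₂ d b) : IsFrame G s c₁ c₂ (b 0) (b (d + 1)) :=
  ⟨h.s_c₁, h.s_c₂, h.s_b 0 (by omega), h.s_b _ le_rfl, h.c₁_last, h.c₂_first, h.centers⟩

theorem reach (h : IsAW G s c₁ c₂ d b) (k : ℕ) (hk : k ≤ d + 1) :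
    Reach G (PathVertex G s c₁ c₂ (b 0) (b (d + 1))) (b (d + 1)) k (b (d + 1 - k)) := by
  induction k with
  | zero => rfl
  | succ k ih =>
    refine ⟨?_, _, ?_, ih (by omega)⟩
    · by_cases e : k = d
      · left; rw [e, Nat.sub_self]
      · right; right
        exact ⟨h.c₁_b _ (by omega) (by omega), h.c₂_b _ (by omega) (by omega),
          h.s_b _ (by omega), (h.s_ne_b _ (by omega)).symm⟩
    · exact (h.path.adj _ (by omega) _ (by omega)).2 (by omega)

/-- In a reduced graph the distance between the base terminals of a long AW, inside the set of
possible path vertices, is that of a long AW. -/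
theorem four_lt_dist (h : IsAW G s c₁ c₂ d b) (hG : IsReduced G) (hd : 3 < d) {N : ℕ} {D : V → ℕ}
    (hD : IsDist G (PathVertex G s c₁ c₂ (b 0) (b (d + 1))) (b (d + 1)) N D) (hN : d + 1 < N) :
    4 < D (b 0) ∧ D (b 0) ≤ d + 1 := by
  have hle : D (b 0) ≤ d + 1 := hD.complete _ _ (by simpa using h.reach (d + 1) le_rfl)
  refine ⟨?_, hle⟩
  have h0 : D (b 0) ≠ 0 := by
    intro e
    have := h.path.inj 0 (by omega) (d + 1) le_rfl (hD.eq_target (by omega) e)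
    omega
  obtain ⟨d', hd'⟩ := Nat.exists_eq_succ_of_ne_zero h0
  obtain ⟨p, hp0, hp⟩ := hD.exists_descent (u := b 0) (by omega)
  obtain ⟨hAW, hlast⟩ := hD.isAW h.isFrame hd' (by omega) hp0 hp
  have h1 : d' ≠ 0 := by
    rintro rfl
    have := (hp 0 (by omega)).1
    rw [hp0, hlast] at this
    exact h.not_adj (by omega) le_rfl this
  have : 3 < d' := by
    refine hAW.three_lt hG ?_
    -- A shortest path with a single inner vertex is excluded differently in the two cases. For `c₁
    -- ≠ c₂` it would be a small `‡`-AW. For `c₁ = c₂` it is not an AW at all, and `not_adj_ends`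
    -- for the given long AW rules it out.
    by_cases e : c₁ = c₂
    · subst e
      left
      by_contra hlt
      obtain rfl : d' = 1 := by omega
      have e1 := (hp 0 (by omega)).1
      have e2 := (hp 1 (by omega)).1
      rw [hp0] at e1
      rw [hlast] at e2
      exact h.not_adj_ends hG hd (hAW.c₁_b 1 le_rfl le_rfl) (hAW.s_b 1 (by omega)) e1.symm e2
    · exact Or.inr ⟨by omega, e⟩
  omega

theorem card_le {n : ℕ} {G : SimpleGraph (Fin n)} {s c₁ c₂ : Fin n} {b : ℕ → Fin n}
    (h : IsAW G s c₁ c₂ d b) : d + 2 ≤ n := by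
  have : Function.Injective (fun i : Fin (d + 2) => b i) := fun i j e =>
    Fin.ext (h.path.inj i (by omega) j (by omega) e)
  simpa using Fintype.card_le_of_injective _ this

end IsAW

end IntervalCompletion

namespace IntervalCompletion

/-! ### The search program

Register `0` holds `n`, register `1` holds `s`, registers `2`–`5` run through the centers `c₁`, `c₂`
and the base terminals `u`, `w`, register `9` holds the length of the best path found so far.
Array `2` holds the row offsets of the adjacency matrix, and array `3` the distances to `w`. -/

namespace Search

open ForProg

/-- Tests whether the vertices in registers `x` and `y` are adjacent. -/
def adjTest (x y : ℕ) : Expr := .read 0 (.add (.read 2 (.reg x)) (.reg y))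

/-- Tests whether the vertex in register `7` may lie on the path. -/
def vertexTest : Expr :=
  .or (.eq (.reg 7) (.reg 4)) (.or (.eq (.reg 7) (.reg 5))
    (.and (adjTest 2 7) (.and (adjTest 3 7) (.and (.not (adjTest 1 7))
      (.not (.eq (.reg 7) (.reg 1)))))))

/-- Tests the conditions on `c₁`, `c₂`, `u` and `w`. -/
def frameTest : Expr :=
  .and (adjTest 1 2) (.and (adjTest 1 3) (.and (.not (adjTest 1 4)) (.and (.not (adjTest 1 5))
    (.and (.not (adjTest 2 5)) (.and (.not (adjTest 3 4))
      (.or (.eq (.reg 2) (.reg 3)) (.and (adjTest 2 3) (.and (adjTest 2 4) (adjTest 3 5)))))))))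

/-- Computes the row offsets of the adjacency matrix. -/
def rowOffsets : ForProg :=
  .forLoop 7 (.write 2 (.add (.reg 7) (.const 1)) (.add (.read 2 (.reg 7)) (.reg 0)))

/-- Initializes the distances to `w`. -/
def initDist : ForProg :=
  .seq (.forLoop 7 (.write 3 (.reg 7) (.reg 0))) (.write 3 (.reg 5) (.const 0))

/-- Relaxes the edge between the vertices in registers `7` and `8`. -/
def relaxEdge : ForProg :=
  .when (.and vertexTest (.and (adjTest 7 8)
      (.lt (.add (.read 3 (.reg 8)) (.const 1)) (.read 3 (.reg 7)))))
    (.write 3 (.reg 7) (.add (.read 3 (.reg 8)) (.const 1)))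

/-- Computes the distances to `w`. -/
def relax : ForProg := .forLoop 6 (.forLoop 7 (.forLoop 8 relaxEdge))

/-- Finds a neighbor of the vertex in register `10` that is closer to `w`. -/
def findNext : ForProg :=
  .seq (.assign 11 (.reg 10)) (.forLoop 7 (.when
    (.and (adjTest 10 7) (.eq (.add (.read 3 (.reg 7)) (.const 1)) (.read 3 (.reg 10))))
    (.assign 11 (.reg 7))))

/-- Writes a shortest path from `u` to `w` to the output. -/
def writePath : ForProg :=
  .seq (.assign 10 (.reg 4)) (.forLoop 6 (.seq (.write 1 (.add (.reg 6) (.const 4)) (.reg 10))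
    (.seq findNext (.assign 10 (.reg 11)))))

/-- Writes the AW given by a shortest path from `u` to `w` to the output. -/
def record : ForProg :=
  .seq (.assign 9 (.read 3 (.reg 4))) (.seq (.write 1 (.const 0) (.sub (.reg 9) (.const 1)))
    (.seq (.write 1 (.const 1) (.reg 1)) (.seq (.write 1 (.const 2) (.reg 2))
      (.seq (.write 1 (.const 3) (.reg 3)) writePath))))

/-- Treats one choice of `c₁`, `c₂`, `u` and `w`. -/
def tryFrame : ForProg :=
  .when frameTest (.seq initDist (.seq relax
    (.when (.and (.lt (.const 4) (.read 3 (.reg 4))) (.lt (.read 3 (.reg 4)) (.reg 9))) record)))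

/-- Finds an AW with shallow terminal `s` and the fewest base vertices. -/
def search : ForProg :=
  .seq rowOffsets (.seq (.assign 9 (.reg 0))
    (.forLoop 2 (.forLoop 3 (.forLoop 4 (.forLoop 5 tryFrame)))))

/-! ### Correctness of the search -/

variable {n : ℕ} {G : SimpleGraph (Fin n)} {s c₁ c₂ u w : Fin n} {σ τ : State}

/-- The state holds the input and the row offsets. -/
structure Ctx (G : SimpleGraph (Fin n)) (s : Fin n) (σ : State) : Prop where
  size : σ.reg 0 = n
  source : σ.reg 1 = s
  adj : ∀ i j : Fin n, σ.arr 0 (σ.arr 2 i + j) ≠ 0 ↔ G.Adj i j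

theorem Ctx.of_agree {rs as : List ℕ} (h : Ctx G s σ) (ha : Agree rs as σ τ)
    (hr : 0 ∉ rs ∧ 1 ∉ rs := by decide) (hs : 0 ∉ as ∧ 2 ∉ as := by decide) : Ctx G s τ where
  size := (ha.1 0 hr.1).trans h.size
  source := (ha.1 1 hr.2).trans h.source
  adj := by rw [ha.2 0 hs.1, ha.2 2 hs.2]; exact h.adj

theorem Ctx.adjTest_iff (h : Ctx G s σ) {x y : ℕ} {i j : Fin n} (hx : σ.reg x = i)
    (hy : σ.reg y = j) : (adjTest x y).eval σ ≠ 0 ↔ G.Adj i j := by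
  rw [← h.adj, ← hx, ← hy]
  rfl

/-- The state moreover holds the centers and the base terminals. -/
structure Env (G : SimpleGraph (Fin n)) (s c₁ c₂ u w : Fin n) (σ : State) : Prop
    extends Ctx G s σ where
  reg_two : σ.reg 2 = c₁
  reg_three : σ.reg 3 = c₂
  reg_four : σ.reg 4 = u
  reg_five : σ.reg 5 = w

theorem Env.of_agree {rs as : List ℕ} (h : Env G s c₁ c₂ u w σ) (ha : Agree rs as σ τ)
    (hr : 0 ∉ rs ∧ 1 ∉ rs ∧ 2 ∉ rs ∧ 3 ∉ rs ∧ 4 ∉ rs ∧ 5 ∉ rs := by decide)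
    (hs : 0 ∉ as ∧ 2 ∉ as := by decide) : Env G s c₁ c₂ u w τ where
  toCtx := h.toCtx.of_agree ha ⟨hr.1, hr.2.1⟩ hs
  reg_two := (ha.1 2 hr.2.2.1).trans h.reg_two
  reg_three := (ha.1 3 hr.2.2.2.1).trans h.reg_three
  reg_four := (ha.1 4 hr.2.2.2.2.1).trans h.reg_four
  reg_five := (ha.1 5 hr.2.2.2.2.2).trans h.reg_five

theorem Env.frameTest_iff (h : Env G s c₁ c₂ u w σ) :
    frameTest.eval σ ≠ 0 ↔ IsFrame G s c₁ c₂ u w := by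
  have e : (Expr.eq (.reg 2) (.reg 3)).eval σ ≠ 0 ↔ c₁ = c₂ := by
    rw [Expr.eq_ne_zero, Fin.ext_iff, ← h.reg_two, ← h.reg_three]
    rfl
  simp only [frameTest, Expr.and_ne_zero, Expr.or_ne_zero, Expr.not_ne_zero, e,
    h.adjTest_iff h.source h.reg_two, h.adjTest_iff h.source h.reg_three,
    h.adjTest_iff h.source h.reg_four, h.adjTest_iff h.source h.reg_five,
    h.adjTest_iff h.reg_two h.reg_five, h.adjTest_iff h.reg_three h.reg_four,
    h.adjTest_iff h.reg_two h.reg_three, h.adjTest_iff h.reg_two h.reg_four,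
    h.adjTest_iff h.reg_three h.reg_five]
  exact ⟨fun ⟨a, b, c, d, e, f, g⟩ => ⟨a, b, c, d, e, f, g⟩,
    fun ⟨a, b, c, d, e, f, g⟩ => ⟨a, b, c, d, e, f, g⟩⟩

theorem Env.vertexTest_iff (h : Env G s c₁ c₂ u w σ) {v : Fin n} (hv : σ.reg 7 = v) :
    vertexTest.eval σ ≠ 0 ↔ PathVertex G s c₁ c₂ u w v := by
  have e : ∀ {x : ℕ} {y : Fin n}, σ.reg x = y →
      ((Expr.eq (.reg 7) (.reg x)).eval σ ≠ 0 ↔ v = y) := by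
    intro x y hy
    rw [Expr.eq_ne_zero, Fin.ext_iff, ← hv, ← hy]
    rfl
  simp only [vertexTest, Expr.and_ne_zero, Expr.or_ne_zero, Expr.not_ne_zero, e h.reg_four,
    e h.reg_five, e h.source, h.adjTest_iff h.source hv, h.adjTest_iff h.reg_two hv,
    h.adjTest_iff h.reg_three hv, PathVertex, ne_eq]

theorem initDist_spec (h : Env G s c₁ c₂ u w σ) (v : Fin n) :
    (initDist.run σ).arr 3 v = if v = w then 0 else n := by
  have key : ∀ v < σ.reg 0, ((ForProg.forLoop 7 (.write 3 (.reg 7) (.reg 0))).run σ).arr 3 v =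
      σ.reg 0 := by
    refine forLoop_induction (by decide) σ
      (fun i τ => ∀ v < i, τ.arr 3 v = σ.reg 0) (by simp) ?_
    intro i hi τ hτ hx ha v hv
    have h0 : τ.reg 0 = σ.reg 0 := ha.1 0 (by decide)
    rcases Nat.lt_succ_iff_lt_or_eq.1 hv with hv | rfl
    · simp [run, Expr.eval, hx, hv.ne, hτ v hv]
    · simp [run, Expr.eval, hx, h0]
  have h5 := (run_agree (.forLoop 7 (.write 3 (.reg 7) (.reg 0))) σ).1 5 (by decide)
  rw [initDist, run]
  generalize (ForProg.forLoop 7 (.write 3 (.reg 7) (.reg 0))).run σ = ρ at *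
  by_cases e : v = w
  · simp [run, Expr.eval, h5, h.reg_five, e]
  · have : (v : ℕ) ≠ w := fun e' => e (Fin.ext e')
    simp [run, Expr.eval, h5, h.reg_five, e, this, key v (by rw [h.size]; exact v.2), h.size]

theorem relaxEdge_spec (h : Env G s c₁ c₂ u w τ) {v v' : Fin n} (hv : τ.reg 7 = v)
    (hv' : τ.reg 8 = v') :
    (∀ x : Fin n, (relaxEdge.run τ).arr 3 x = τ.arr 3 x ∨
      x = v ∧ PathVertex G s c₁ c₂ u w v ∧ G.Adj v v' ∧ τ.arr 3 v' + 1 < τ.arr 3 v ∧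
        (relaxEdge.run τ).arr 3 x = τ.arr 3 v' + 1) ∧
    (PathVertex G s c₁ c₂ u w v → G.Adj v v' → (relaxEdge.run τ).arr 3 v ≤ τ.arr 3 v' + 1) := by
  have hcond : (Expr.and vertexTest (.and (adjTest 7 8)
      (.lt (.add (.read 3 (.reg 8)) (.const 1)) (.read 3 (.reg 7))))).eval τ ≠ 0 ↔
      PathVertex G s c₁ c₂ u w v ∧ G.Adj v v' ∧ τ.arr 3 v' + 1 < τ.arr 3 v := by
    rw [Expr.and_ne_zero, Expr.and_ne_zero, h.vertexTest_iff hv, h.adjTest_iff hv hv',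
      Expr.lt_ne_zero, ← hv, ← hv']
    rfl
  rw [relaxEdge, run]
  split_ifs with hc
  · have hc' := hcond.1 hc
    have hrun : ∀ x : Fin n,
        (run (.write 3 (.reg 7) (.add (.read 3 (.reg 8)) (.const 1))) τ).arr 3 x =
          if x = v then τ.arr 3 v' + 1 else τ.arr 3 x := by
      intro x
      simp [run, Expr.eval, hv, hv', Function.update_apply, Fin.ext_iff]
    refine ⟨fun x => ?_, fun _ _ => by rw [hrun, if_pos rfl]⟩
    rw [hrun]
    by_cases e : x = v
    · exact Or.inr ⟨e, hc'.1, hc'.2.1, hc'.2.2, by rw [if_pos e]⟩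
    · exact Or.inl (by rw [if_neg e])
  · refine ⟨fun x => Or.inl rfl, fun h1 h2 => ?_⟩
    by_contra hlt
    exact hc (hcond.2 ⟨h1, h2, by omega⟩)

/-- The distances in array `3` are lengths of walks, and they are at most the length of any walk
with at most `k` edges. -/
structure Relaxed (G : SimpleGraph (Fin n)) (B : Fin n → Prop) (w : Fin n) (k : ℕ) (σ : State) :
    Prop where
  le : ∀ v : Fin n, σ.arr 3 v ≤ n
  sound : ∀ v : Fin n, σ.arr 3 v < n → Reach G B w (σ.arr 3 v) v
  complete : ∀ j ≤ k, ∀ v : Fin n, Reach G B w j v → σ.arr 3 v ≤ j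

/-- A new entry is the length of a walk extended by one edge, so soundness persists; entries only
decrease, so upper bounds persist. -/
theorem Relaxed.relaxEdge {k : ℕ} (hR : Relaxed G (PathVertex G s c₁ c₂ u w) w k τ)
    (h : Env G s c₁ c₂ u w τ) {v v' : Fin n} (hv : τ.reg 7 = v) (hv' : τ.reg 8 = v') :
    Relaxed G (PathVertex G s c₁ c₂ u w) w k (relaxEdge.run τ) ∧
      ∀ x : Fin n, (relaxEdge.run τ).arr 3 x ≤ τ.arr 3 x := by
  have hs := (relaxEdge_spec h hv hv').1
  have hmono : ∀ x : Fin n, (Search.relaxEdge.run τ).arr 3 x ≤ τ.arr 3 x := by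
    intro x
    rcases hs x with e | ⟨rfl, -, -, hlt, e⟩ <;> omega
  refine ⟨⟨fun x => (hmono x).trans (hR.le x), fun x hx => ?_,
    fun j hj x hx => (hmono x).trans (hR.complete j hj x hx)⟩, hmono⟩
  rcases hs x with e | ⟨rfl, hB, hadj, hlt, e⟩
  · rw [e] at hx ⊢
    exact hR.sound x hx
  · rw [e] at hx ⊢
    exact ⟨hB, v', hadj, hR.sound v' (by omega)⟩

theorem relax_spec (h : Env G s c₁ c₂ u w σ)
    (hσ : ∀ v : Fin n, σ.arr 3 v = if v = w then 0 else n) :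
    IsDist G (PathVertex G s c₁ c₂ u w) w n (fun v => (relax.run σ).arr 3 v) := by
  -- Each of the `n` rounds over all ordered pairs of vertices raises by one the number of edges up
  -- to which the entries are bounded by walk lengths.
  have key : Relaxed G (PathVertex G s c₁ c₂ u w) w (σ.reg 0) (relax.run σ) := by
    refine forLoop_induction (by decide) σ
      (fun k τ => Relaxed G (PathVertex G s c₁ c₂ u w) w k τ) ⟨?_, ?_, ?_⟩ ?_
    · intro v
      simp only [State.setReg_arr, hσ]
      split_ifs <;> omega
    · intro v hv
      simp only [State.setReg_arr, hσ] at hv ⊢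
      split_ifs at hv ⊢ with e
      · exact e
      · omega
    · intro j hj v hv
      obtain rfl : j = 0 := by omega
      obtain rfl : v = w := hv
      simp [hσ]
    intro k hk τ hτ hk' ha
    have hE : Env G s c₁ c₂ u w τ := h.of_agree ha
    have hmid : Relaxed G (PathVertex G s c₁ c₂ u w) w k
          ((ForProg.forLoop 7 (.forLoop 8 relaxEdge)).run τ) ∧
        ∀ v : Fin n, (v : ℕ) < τ.reg 0 → Reach G (PathVertex G s c₁ c₂ u w) w (k + 1) v →
          ((ForProg.forLoop 7 (.forLoop 8 relaxEdge)).run τ).arr 3 v ≤ k + 1 := by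
      refine forLoop_induction (by decide) τ
        (fun i ρ => Relaxed G (PathVertex G s c₁ c₂ u w) w k ρ ∧
          ∀ v : Fin n, (v : ℕ) < i → Reach G (PathVertex G s c₁ c₂ u w) w (k + 1) v →
            ρ.arr 3 v ≤ k + 1) ⟨⟨hτ.le, hτ.sound, hτ.complete⟩, by simp⟩ ?_
      intro i hi ρ hρ hi' ha'
      have hE' : Env G s c₁ c₂ u w ρ := hE.of_agree ha'
      have hin : i < n := hE.size ▸ hi
      have hinner : Relaxed G (PathVertex G s c₁ c₂ u w) w k
            ((ForProg.forLoop 8 relaxEdge).run ρ) ∧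
          (∀ v : Fin n, ((ForProg.forLoop 8 relaxEdge).run ρ).arr 3 v ≤ ρ.arr 3 v) ∧
          ∀ v' : Fin n, (v' : ℕ) < ρ.reg 0 → PathVertex G s c₁ c₂ u w ⟨i, hin⟩ →
            G.Adj ⟨i, hin⟩ v' → Reach G (PathVertex G s c₁ c₂ u w) w k v' →
            ((ForProg.forLoop 8 relaxEdge).run ρ).arr 3 i ≤ k + 1 := by
        refine forLoop_induction (by decide) ρ
          (fun i' π => Relaxed G (PathVertex G s c₁ c₂ u w) w k π ∧
            (∀ v : Fin n, π.arr 3 v ≤ ρ.arr 3 v) ∧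
            ∀ v' : Fin n, (v' : ℕ) < i' → PathVertex G s c₁ c₂ u w ⟨i, hin⟩ →
              G.Adj ⟨i, hin⟩ v' → Reach G (PathVertex G s c₁ c₂ u w) w k v' →
              π.arr 3 i ≤ k + 1) ⟨⟨hρ.1.le, hρ.1.sound, hρ.1.complete⟩, by simp, by simp⟩ ?_
        rintro i' hi'' π ⟨h1, h2, h3⟩ h8 ha''
        have hE'' : Env G s c₁ c₂ u w π := hE'.of_agree ha''
        have h7 : π.reg 7 = (⟨i, hin⟩ : Fin n) := (ha''.1 7 (by decide)).trans hi'
        have hin' : i' < n := hE'.size ▸ hi''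
        obtain ⟨hR, hmono⟩ := h1.relaxEdge hE'' h7 (v' := ⟨i', hin'⟩) h8
        refine ⟨⟨hR.le, hR.sound, hR.complete⟩, fun v => (hmono v).trans (h2 v), ?_⟩
        intro v' hv' hB hadj hr
        rcases Nat.lt_succ_iff_lt_or_eq.1 hv' with hlt | heq
        · exact (hmono ⟨i, hin⟩).trans (h3 v' hlt hB hadj hr)
        · obtain rfl : v' = ⟨i', hin'⟩ := Fin.ext heq
          -- Updates happen in place, so the entry of `v'` may already be lowered within this round;
          -- only the bound `k` on it is needed.
          have := (relaxEdge_spec hE'' h7 h8).2 hB hadj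
          have := h1.complete k le_rfl _ hr
          simp only [State.setReg_arr] at *
          omega
      obtain ⟨h1, h2, h3⟩ := hinner
      refine ⟨⟨h1.le, h1.sound, h1.complete⟩, ?_⟩
      intro v hv hr
      rcases Nat.lt_succ_iff_lt_or_eq.1 hv with hlt | heq
      · exact (h2 v).trans (hρ.2 v hlt hr)
      · obtain rfl : v = ⟨i, hin⟩ := Fin.ext heq
        obtain ⟨hB, v', hadj, hr'⟩ := hr
        exact h3 v' (hE'.size.symm ▸ v'.2) hB hadj hr'
    refine ⟨hmid.1.le, hmid.1.sound, fun j hj v hr => ?_⟩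
    rcases Nat.le_succ_iff.1 hj with hj | rfl
    · exact hmid.1.complete j hj v hr
    · exact hmid.2 v (hE.size.symm ▸ v.2) hr
  refine ⟨key.sound, fun k v hr => ?_⟩
  -- Walks with more than `n` edges need no rounds, because no entry exceeds the initial value `n`.
  rcases le_total k n with hk | hk
  · exact key.complete k (h.size.symm ▸ hk) v hr
  · exact (key.le v).trans hk

/-- Register `11` starts with `c` itself, so the result is a vertex even when no closer neighbour
exists, as happens once the descent has reached `w`. -/
theorem findNext_spec (h : Ctx G s σ) {c : Fin n} (hc : σ.reg 10 = c) :
    ∃ y : Fin n, (findNext.run σ).reg 11 = y ∧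
      ((∃ v : Fin n, G.Adj c v ∧ σ.arr 3 v + 1 = σ.arr 3 c) →
        G.Adj c y ∧ σ.arr 3 y + 1 = σ.arr 3 c) := by
  rw [findNext, run]
  have h' : Ctx G s ((ForProg.assign 11 (.reg 10)).run σ) := h.of_agree (run_agree _ _)
  have hc' : ((ForProg.assign 11 (.reg 10)).run σ).reg 10 = c := hc
  have h11 : ((ForProg.assign 11 (.reg 10)).run σ).reg 11 = c := hc
  have h3 : ((ForProg.assign 11 (.reg 10)).run σ).arr 3 = σ.arr 3 := rfl
  generalize (ForProg.assign 11 (.reg 10)).run σ = ρ at *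
  rw [← h3]
  have key := forLoop_induction (x := 7) (P := .when
    (.and (adjTest 10 7) (.eq (.add (.read 3 (.reg 7)) (.const 1)) (.read 3 (.reg 10))))
    (.assign 11 (.reg 7))) (by decide) ρ
    (fun i τ => ∃ y : Fin n, τ.reg 11 = y ∧
      ((∃ v : Fin n, (v : ℕ) < i ∧ G.Adj c v ∧ ρ.arr 3 v + 1 = ρ.arr 3 c) →
        G.Adj c y ∧ ρ.arr 3 y + 1 = ρ.arr 3 c)) ⟨c, h11, by simp⟩ ?_
  · obtain ⟨y, hy, hy'⟩ := key
    exact ⟨y, hy, fun ⟨v, hv⟩ => hy' ⟨v, h'.size.symm ▸ v.2, hv⟩⟩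
  · rintro i hi τ ⟨y, hy, hy'⟩ hx ha
    have hin : i < n := h'.size ▸ hi
    have hτ : Ctx G s τ := h'.of_agree ha
    have h10 : τ.reg 10 = c := (ha.1 10 (by decide)).trans hc'
    have h3' : τ.arr 3 = ρ.arr 3 := ha.2 3 (by decide)
    have hcond : (Expr.and (adjTest 10 7)
        (.eq (.add (.read 3 (.reg 7)) (.const 1)) (.read 3 (.reg 10)))).eval τ ≠ 0 ↔
        G.Adj c ⟨i, hin⟩ ∧ ρ.arr 3 i + 1 = ρ.arr 3 c := by
      rw [Expr.and_ne_zero, hτ.adjTest_iff h10 (j := ⟨i, hin⟩) hx, Expr.eq_ne_zero, ← h3', ← h10]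
      simp only [Expr.eval, hx]
    rw [run]
    split_ifs with hif
    · exact ⟨⟨i, hin⟩, by simp [run, Expr.eval, hx], fun _ => hcond.1 hif⟩
    · refine ⟨y, by simpa using hy, ?_⟩
      rintro ⟨v, hv, hv'⟩
      rcases Nat.lt_succ_iff_lt_or_eq.1 hv with hlt | heq
      · exact hy' ⟨v, hlt, hv'⟩
      · obtain rfl : v = ⟨i, hin⟩ := Fin.ext heq
        exact absurd (hcond.2 hv') hif

theorem writePath_spec {B : Fin n → Prop} (h : Env G s c₁ c₂ u w σ)
    (hD : IsDist G B w n (fun v => σ.arr 3 v)) (hu : σ.arr 3 u < n) :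
    ∃ p : ℕ → Fin n, p 0 = u ∧
      (∀ k < σ.arr 3 u, G.Adj (p k) (p (k + 1)) ∧ σ.arr 3 (p (k + 1)) + 1 = σ.arr 3 (p k)) ∧
      (∀ k ≤ σ.arr 3 u, (writePath.run σ).arr 1 (k + 4) = p k) ∧
      ∀ k < 4, (writePath.run σ).arr 1 k = σ.arr 1 k := by
  rw [writePath, run]
  have h' : Env G s c₁ c₂ u w ((ForProg.assign 10 (.reg 4)).run σ) := h.of_agree (run_agree _ _)
  have h10 : ((ForProg.assign 10 (.reg 4)).run σ).reg 10 = u := h.reg_four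
  have harr : ((ForProg.assign 10 (.reg 4)).run σ).arr = σ.arr := rfl
  generalize (ForProg.assign 10 (.reg 4)).run σ = ρ at *
  rw [← harr] at hD hu ⊢
  have key := forLoop_induction (x := 6) (P := .seq (.write 1 (.add (.reg 6) (.const 4)) (.reg 10))
    (.seq findNext (.assign 10 (.reg 11)))) (by decide) ρ
    (fun i τ => ∃ p : ℕ → Fin n, p 0 = u ∧
      (∀ k < i, k < ρ.arr 3 u →
        G.Adj (p k) (p (k + 1)) ∧ ρ.arr 3 (p (k + 1)) + 1 = ρ.arr 3 (p k)) ∧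
      (i ≤ ρ.arr 3 u → ρ.arr 3 (p i) + i = ρ.arr 3 u) ∧ τ.reg 10 = p i ∧
      (∀ k < i, τ.arr 1 (k + 4) = p k) ∧ ∀ k < 4, τ.arr 1 k = ρ.arr 1 k)
    ⟨fun _ => u, rfl, by simp, by simp, by simpa using h10, by simp, by simp⟩ ?_
  · obtain ⟨p, hp0, hp, -, -, hout, hhead⟩ := key
    rw [h'.size] at hp hout
    -- The `n` rounds fill the cells for `k < n`, which include all `k` up to the distance of `u`,
    -- as that is less than `n`. Cells written after the end of the path do not matter, since only
    -- the listed output is compared.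
    exact ⟨p, hp0, fun k hk => hp k (by omega) hk, fun k hk => hout k (by omega), hhead⟩
  · rintro i hi τ ⟨p, hp0, hp, hDi, hi10, hout, hhead⟩ hx ha
    simp only [run]
    have hτ : Env G s c₁ c₂ u w τ := h'.of_agree ha
    have hτ3 : τ.arr 3 = ρ.arr 3 := ha.2 3 (by decide)
    have hE : Ctx G s (τ.setCell 1 (Expr.eval τ (.add (.reg 6) (.const 4)))
      (Expr.eval τ (.reg 10))) :=
      hτ.toCtx.of_agree (run_agree (.write 1 (.add (.reg 6) (.const 4)) (.reg 10)) τ)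
    obtain ⟨y, hy, hy'⟩ := findNext_spec hE (c := p i) hi10
    have hag := (run_agree findNext (τ.setCell 1 (Expr.eval τ (.add (.reg 6) (.const 4)))
      (Expr.eval τ (.reg 10)))).2 1 (by decide)
    have harr1 : ∀ j, (findNext.run (τ.setCell 1 (Expr.eval τ (.add (.reg 6) (.const 4)))
        (Expr.eval τ (.reg 10)))).arr 1 j = if j = i + 4 then (p i : ℕ) else τ.arr 1 j := by
      intro j
      rw [hag]
      simp [Expr.eval, hx, hi10, Function.update_apply]
    generalize findNext.run (τ.setCell 1 (Expr.eval τ (.add (.reg 6) (.const 4)))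
      (Expr.eval τ (.reg 10))) = π at *
    have hstep : i < ρ.arr 3 u → G.Adj (p i) y ∧ ρ.arr 3 y + 1 = ρ.arr 3 (p i) := by
      intro hlt
      have hd := hDi hlt.le
      have hex := hD.exists_next (v := p i) (by omega) (by omega)
      simpa [hτ3] using hy' (by simpa [hτ3] using hex)
    refine ⟨fun k => if k ≤ i then p k else y, by simpa using hp0, ?_, ?_, ?_, ?_, ?_⟩
    · intro k hk hku
      rcases Nat.lt_succ_iff_lt_or_eq.1 hk with hlt | rfl
      · simpa [show k ≤ i by omega, show k + 1 ≤ i by omega] using hp k hlt hku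
      · simpa using hstep hku
    · intro hle
      have h1 := hDi (by omega)
      have h2 := (hstep (by omega)).2
      simp only [show ¬ i + 1 ≤ i by omega, if_false]
      omega
    · simp [Expr.eval, hy]
    · intro k hk
      simp only [State.setReg_arr, harr1]
      rcases Nat.lt_succ_iff_lt_or_eq.1 hk with hlt | rfl
      · simpa [hlt.ne, hlt.le] using hout k hlt
      · simp
    · intro k hk
      simp only [State.setReg_arr, harr1]
      rw [if_neg (by omega)]
      exact hhead k hk

/-- Register `9` holds `n`, or the output holds a long AW with `d` base vertices and register `9`
holds `d + 1`. -/
def BestInv (G : SimpleGraph (Fin n)) (s : Fin n) (σ : State) : Prop :=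
  σ.reg 9 = n ∨ ∃ (c₁ c₂ : Fin n) (d : ℕ) (b : ℕ → Fin n), IsAW G s c₁ c₂ d b ∧ 3 < d ∧
    σ.reg 9 = d + 1 ∧ σ.arr 1 0 = d ∧ σ.arr 1 1 = s ∧ σ.arr 1 2 = c₁ ∧ σ.arr 1 3 = c₂ ∧
    ∀ k ≤ d + 1, σ.arr 1 (k + 4) = b k

theorem BestInv.congr (h : BestInv G s σ) (h9 : τ.reg 9 = σ.reg 9) (h1 : τ.arr 1 = σ.arr 1) :
    BestInv G s τ := by
  unfold BestInv
  rw [h9, h1]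
  exact h

theorem record_spec (h : Env G s c₁ c₂ u w σ) (hF : IsFrame G s c₁ c₂ u w)
    (hD : IsDist G (PathVertex G s c₁ c₂ u w) w n (fun v => σ.arr 3 v)) (hu : σ.arr 3 u < n)
    (h4 : 4 < σ.arr 3 u) :
    BestInv G s (record.run σ) ∧ (record.run σ).reg 9 = σ.arr 3 u := by
  let head : ForProg := .seq (.assign 9 (.read 3 (.reg 4)))
    (.seq (.write 1 (.const 0) (.sub (.reg 9) (.const 1)))
    (.seq (.write 1 (.const 1) (.reg 1)) (.seq (.write 1 (.const 2) (.reg 2))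
      (.write 1 (.const 3) (.reg 3)))))
  have hrec : record.run σ = writePath.run (head.run σ) := rfl
  have h' : Env G s c₁ c₂ u w (head.run σ) := h.of_agree (run_agree head σ)
  have h3 : (head.run σ).arr 3 = σ.arr 3 := (run_agree head σ).2 3 (by decide)
  have h9 : (head.run σ).reg 9 = σ.arr 3 u := by
    simp [head, run, Expr.eval, h.reg_four]
  have e0 : (head.run σ).arr 1 0 = σ.arr 3 u - 1 := by
    simp [head, run, Expr.eval, h.reg_four]
  have e1 : (head.run σ).arr 1 1 = s := by
    simp [head, run, Expr.eval, h.source]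
  have e2 : (head.run σ).arr 1 2 = c₁ := by
    simp [head, run, Expr.eval, h.reg_two]
  have e3 : (head.run σ).arr 1 3 = c₂ := by
    simp [head, run, Expr.eval, h.reg_three]
  rw [hrec]
  generalize head.run σ = ρ at *
  rw [← h3] at hD hu h4 h9 e0 ⊢
  obtain ⟨p, hp0, hp, hout, hhead⟩ := writePath_spec h' hD hu
  have hreg : (writePath.run ρ).reg 9 = ρ.arr 3 u :=
    ((run_agree writePath ρ).1 9 (by decide)).trans h9
  obtain ⟨d, hd⟩ : ∃ d, ρ.arr 3 u = d + 1 := ⟨ρ.arr 3 u - 1, by omega⟩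
  obtain ⟨hAW, -⟩ := hD.isAW hF (p := p) hd hu hp0 hp
  refine ⟨Or.inr ⟨c₁, c₂, d, p, hAW, by omega, by omega, ?_, ?_, ?_, ?_, ?_⟩, hreg⟩
  · rw [hhead 0 (by omega), e0, hd]; rfl
  · rw [hhead 1 (by omega), e1]
  · rw [hhead 2 (by omega), e2]
  · rw [hhead 3 (by omega), e3]
  · intro k hk
    exact hout k (by omega)

theorem tryFrame_spec (hG : IsReduced G) (h : Env G s c₁ c₂ u w σ) (hB : BestInv G s σ)
    (hn : σ.reg 9 ≤ n) :
    BestInv G s (tryFrame.run σ) ∧ (tryFrame.run σ).reg 9 ≤ σ.reg 9 ∧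
      ∀ d b, IsAW G s c₁ c₂ d b → 3 < d → b 0 = u → b (d + 1) = w →
        (tryFrame.run σ).reg 9 ≤ d + 1 := by
  rw [tryFrame, run]
  split_ifs with hF
  swap
  · refine ⟨hB, le_rfl, ?_⟩
    rintro d b hAW hd rfl rfl
    exact absurd (h.frameTest_iff.2 hAW.isFrame) hF
  rw [h.frameTest_iff] at hF
  simp only [run.eq_3]
  have h₁ : Env G s c₁ c₂ u w (initDist.run σ) := h.of_agree (run_agree _ _)
  have hD := relax_spec h₁ (initDist_spec h)
  have h₂ : Env G s c₁ c₂ u w (relax.run (initDist.run σ)) := h₁.of_agree (run_agree _ _)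
  have e9 : (relax.run (initDist.run σ)).reg 9 = σ.reg 9 :=
    ((run_agree relax _).1 9 (by decide)).trans ((run_agree initDist _).1 9 (by decide))
  have e1 : (relax.run (initDist.run σ)).arr 1 = σ.arr 1 :=
    ((run_agree relax _).2 1 (by decide)).trans ((run_agree initDist _).2 1 (by decide))
  generalize relax.run (initDist.run σ) = ρ at *
  have hlow : ∀ d b, IsAW G s c₁ c₂ d b → 3 < d → b 0 = u → b (d + 1) = w →
      -- An AW with these centers and base terminals passes the test `4 < D u`, so the test discards
      -- only choices that belong to no long AW.
      4 < ρ.arr 3 u ∧ ρ.arr 3 u ≤ d + 1 := by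
    rintro d b hAW hd rfl rfl
    exact hAW.four_lt_dist hG hd hD hAW.card_le
  rw [run]
  have hcond : (Expr.and (.lt (.const 4) (.read 3 (.reg 4)))
      (.lt (.read 3 (.reg 4)) (.reg 9))).eval ρ ≠ 0 ↔ 4 < ρ.arr 3 u ∧ ρ.arr 3 u < ρ.reg 9 := by
    rw [Expr.and_ne_zero, Expr.lt_ne_zero, Expr.lt_ne_zero, ← h₂.reg_four]
    rfl
  split_ifs with hc
  · rw [hcond] at hc
    obtain ⟨hb, hr⟩ := record_spec h₂ hF hD (by omega) hc.1
    exact ⟨hb, by omega, fun d b hAW hd h0 h1 => hr ▸ (hlow d b hAW hd h0 h1).2⟩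
  · refine ⟨hB.congr e9 e1, e9.le, fun d b hAW hd h0 h1 => ?_⟩
    obtain ⟨l1, l2⟩ := hlow d b hAW hd h0 h1
    by_contra hlt
    exact hc (hcond.2 ⟨l1, by omega⟩)

/-- The loop rule for a search: if the `i`-th round brings register `9` below the bounds in `S i`,
the loop brings it below all of these bounds. -/
theorem forLoop_best {x : ℕ} {P : ForProg} (hx : x ∉ P.regs) (hx9 : x ≠ 9) (S : ℕ → Set ℕ)
    (hσ : BestInv G s σ)
    (hP : ∀ i < σ.reg 0, ∀ τ, Agree (x :: P.regs) P.arrs σ τ → τ.reg x = i →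
      τ.reg 9 ≤ σ.reg 9 → BestInv G s τ →
      BestInv G s (P.run τ) ∧ (P.run τ).reg 9 ≤ τ.reg 9 ∧ ∀ m ∈ S i, (P.run τ).reg 9 ≤ m) :
    BestInv G s ((forLoop x P).run σ) ∧ ((forLoop x P).run σ).reg 9 ≤ σ.reg 9 ∧
      ∀ i < σ.reg 0, ∀ m ∈ S i, ((forLoop x P).run σ).reg 9 ≤ m := by
  refine forLoop_induction hx σ (fun k τ => BestInv G s τ ∧ τ.reg 9 ≤ σ.reg 9 ∧
    ∀ i < k, ∀ m ∈ S i, τ.reg 9 ≤ m) ⟨hσ.congr ?_ rfl, ?_, by simp⟩ ?_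
  · simp [hx9.symm]
  · simp [hx9.symm]
  · rintro k hk τ ⟨h1, h2, h3⟩ hxk ha
    obtain ⟨g1, g2, g3⟩ := hP k hk τ ha hxk h2 h1
    have e9 : ((P.run τ).setReg x (k + 1)).reg 9 = (P.run τ).reg 9 := by simp [hx9.symm]
    rw [e9]
    refine ⟨g1.congr e9 rfl, g2.trans h2, fun i hi m hm => ?_⟩
    rcases Nat.lt_succ_iff_lt_or_eq.1 hi with hlt | rfl
    · exact g2.trans (h3 i hlt m hm)
    · exact g3 m hm

theorem rowOffsets_spec (G : SimpleGraph (Fin n)) (s : Fin n) :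
    Ctx G s (rowOffsets.run (inputState G s)) := by
  have ha := run_agree rowOffsets (inputState G s)
  have hrow : ∀ i ≤ (inputState G s).reg 0,
      (rowOffsets.run (inputState G s)).arr 2 i = i * n := by
    refine forLoop_induction (by decide) _ (fun k τ => ∀ i ≤ k, τ.arr 2 i = i * n) ?_ ?_
    · intro i hi
      obtain rfl : i = 0 := by omega
      simp [inputState]
    · intro k hk τ hτ hx ha i hi
      have h0 : τ.reg 0 = n := ha.1 0 (by decide)
      rcases Nat.le_succ_iff.1 hi with hlt | rfl
      · simpa [run, Expr.eval, hx, show i ≠ k + 1 by omega] using hτ i hlt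
      · simp [run, Expr.eval, hx, h0, hτ k le_rfl, Nat.succ_mul]
  refine ⟨ha.1 0 (by decide), ha.1 1 (by decide), fun i j => ?_⟩
  rw [ha.2 0 (by decide), hrow i (show (i : ℕ) ≤ n from i.2.le)]
  -- A matrix cell determines its row and column, by division with remainder by `n`.
  have hiff : (∃ i' j' : Fin n, (i : ℕ) * n + j = i' * n + j' ∧ G.Adj i' j') ↔ G.Adj i j := by
    refine ⟨?_, fun h => ⟨i, j, rfl, h⟩⟩
    rintro ⟨i', j', e, hadj⟩
    have hn : 0 < n := i.pos
    have hj : (j : ℕ) = j' := by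
      have := congrArg (· % n) e
      simpa [Nat.mul_add_mod', Nat.mod_eq_of_lt] using this
    have hi : (i : ℕ) = i' := by
      rw [hj] at e
      exact Nat.eq_of_mul_eq_mul_right hn (Nat.add_right_cancel e)
    rwa [Fin.ext hi, Fin.ext hj]
  rw [← hiff]
  simp [inputState]

/-- The bounds passed to `forLoop_best` are the values `d + 1` of the long AWs that agree with the
loop variables fixed so far. Each nested loop fixes one more of `c₁`, `c₂`, `b 0`, `b (d + 1)`,
until `tryFrame_spec` applies. -/
theorem search_spec (hG : IsReduced G) (s : Fin n) :
    BestInv G s (search.run (inputState G s)) ∧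
      ∀ c₁ c₂ d b, IsAW G s c₁ c₂ d b → 3 < d → (search.run (inputState G s)).reg 9 ≤ d + 1 := by
  rw [search, run, run]
  have hC : Ctx G s ((ForProg.assign 9 (.reg 0)).run (rowOffsets.run (inputState G s))) :=
    (rowOffsets_spec G s).of_agree (run_agree _ _)
  have h9 : ((ForProg.assign 9 (.reg 0)).run (rowOffsets.run (inputState G s))).reg 9 = n :=
    (rowOffsets_spec G s).size
  generalize (ForProg.assign 9 (.reg 0)).run (rowOffsets.run (inputState G s)) = σ at *
  have key := forLoop_best (G := G) (s := s) (x := 2)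
    (P := .forLoop 3 (.forLoop 4 (.forLoop 5 tryFrame))) (σ := σ) (by decide) (by decide)
    (fun i => {m | ∃ c₁ c₂ d b, IsAW G s c₁ c₂ d b ∧ 3 < d ∧ m = d + 1 ∧ (c₁ : ℕ) = i})
    (Or.inl h9) ?_
  · refine ⟨key.1, fun c₁ c₂ d b hAW hd => ?_⟩
    exact key.2.2 c₁ (hC.size.symm ▸ c₁.2) _ ⟨c₁, c₂, d, b, hAW, hd, rfl, rfl⟩
  intro i₁ hi₁ σ₁ ha₁ hx₁ hn₁ hB₁
  have hC₁ : Ctx G s σ₁ := hC.of_agree ha₁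
  rw [hC.size] at hi₁
  have key := forLoop_best (G := G) (s := s) (x := 3) (P := .forLoop 4 (.forLoop 5 tryFrame))
    (σ := σ₁) (by decide) (by decide)
    (fun i => {m | ∃ c₁ c₂ d b, IsAW G s c₁ c₂ d b ∧ 3 < d ∧ m = d + 1 ∧ (c₁ : ℕ) = i₁ ∧
      (c₂ : ℕ) = i}) hB₁ ?_
  · refine ⟨key.1, key.2.1, ?_⟩
    rintro m ⟨c₁, c₂, d, b, hAW, hd, hm, h1⟩
    exact key.2.2 c₂ (hC₁.size.symm ▸ c₂.2) _ ⟨c₁, c₂, d, b, hAW, hd, hm, h1, rfl⟩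
  intro i₂ hi₂ σ₂ ha₂ hx₂ hn₂ hB₂
  have hC₂ : Ctx G s σ₂ := hC₁.of_agree ha₂
  have hx₁₂ : σ₂.reg 2 = i₁ := (ha₂.1 2 (by decide)).trans hx₁
  rw [hC₁.size] at hi₂
  have key := forLoop_best (G := G) (s := s) (x := 4) (P := .forLoop 5 tryFrame)
    (σ := σ₂) (by decide) (by decide)
    (fun i => {m | ∃ c₁ c₂ d b, IsAW G s c₁ c₂ d b ∧ 3 < d ∧ m = d + 1 ∧ (c₁ : ℕ) = i₁ ∧
      (c₂ : ℕ) = i₂ ∧ (b 0 : ℕ) = i}) hB₂ ?_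
  · refine ⟨key.1, key.2.1, ?_⟩
    rintro m ⟨c₁, c₂, d, b, hAW, hd, hm, h1, h2⟩
    exact key.2.2 (b 0) (hC₂.size.symm ▸ (b 0).2) _ ⟨c₁, c₂, d, b, hAW, hd, hm, h1, h2, rfl⟩
  intro i₃ hi₃ σ₃ ha₃ hx₃ hn₃ hB₃
  have hC₃ : Ctx G s σ₃ := hC₂.of_agree ha₃
  have hx₁₃ : σ₃.reg 2 = i₁ := (ha₃.1 2 (by decide)).trans hx₁₂
  have hx₂₃ : σ₃.reg 3 = i₂ := (ha₃.1 3 (by decide)).trans hx₂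
  rw [hC₂.size] at hi₃
  have key := forLoop_best (G := G) (s := s) (x := 5) (P := tryFrame)
    (σ := σ₃) (by decide) (by decide)
    (fun i => {m | ∃ c₁ c₂ d b, IsAW G s c₁ c₂ d b ∧ 3 < d ∧ m = d + 1 ∧ (c₁ : ℕ) = i₁ ∧
      (c₂ : ℕ) = i₂ ∧ (b 0 : ℕ) = i₃ ∧ (b (d + 1) : ℕ) = i}) hB₃ ?_
  · refine ⟨key.1, key.2.1, ?_⟩
    rintro m ⟨c₁, c₂, d, b, hAW, hd, hm, h1, h2, h3⟩
    exact key.2.2 (b (d + 1)) (hC₃.size.symm ▸ (b (d + 1)).2) _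
      ⟨c₁, c₂, d, b, hAW, hd, hm, h1, h2, h3, rfl⟩
  intro i₄ hi₄ σ₄ ha₄ hx₄ hn₄ hB₄
  rw [hC₃.size] at hi₄
  have hE : Env G s ⟨i₁, hi₁⟩ ⟨i₂, hi₂⟩ ⟨i₃, hi₃⟩ ⟨i₄, hi₄⟩ σ₄ :=
    ⟨hC₃.of_agree ha₄, (ha₄.1 2 (by decide)).trans hx₁₃, (ha₄.1 3 (by decide)).trans hx₂₃,
      (ha₄.1 4 (by decide)).trans hx₃, hx₄⟩
  obtain ⟨g1, g2, g3⟩ := tryFrame_spec hG hE hB₄ (by omega)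
  refine ⟨g1, g2, ?_⟩
  rintro m ⟨c₁, c₂, d, b, hAW, hd, rfl, h1, h2, h3, h4⟩
  obtain rfl : c₁ = ⟨i₁, hi₁⟩ := Fin.ext h1
  obtain rfl : c₂ = ⟨i₂, hi₂⟩ := Fin.ext h2
  exact g3 d b hAW hd (Fin.ext h3) (Fin.ext h4)

/-- The search ends with a good AW as its output. -/
theorem exists_outputs (hG : IsReduced G) (hs : s ∈ ST G) :
    ∃ W : LongAW G, IsGoodAW G s W ∧ (search.run (inputState G s)).Outputs W.toList := by
  obtain ⟨hB, hmin⟩ := search_spec hG s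
  generalize search.run (inputState G s) = σ at *
  obtain ⟨W₀, rfl⟩ := hs
  obtain ⟨hd₀, b₀, hb₀, -⟩ := W₀.exists_isAW
  have hlt := hmin _ _ _ _ hb₀ hd₀
  have hcard := hb₀.card_le
  -- Register `9` has dropped below its initial value `n`: it is at most `W₀.d + 1`, and the path of
  -- `W₀` has `W₀.d + 2 ≤ n` vertices.
  obtain ⟨c₁, c₂, d, b, hAW, hd, h9, h0, h1, h2, h3, h4⟩ := hB.resolve_left (by omega)
  obtain ⟨W, hWd, hWs, hW1, hW2, hWp⟩ := hAW.exists_longAW hd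
  refine ⟨W, ?_, ?_⟩
  · rw [← hWs]
    refine isGoodAW_of_minimal hG W fun W' hW' => ?_
    obtain ⟨hd', b', hb', -⟩ := W'.exists_isAW
    rw [hW', hWs] at hb'
    have := hmin _ _ _ _ hb' hd'
    omega
  · rintro ⟨i, hi⟩
    simp only [LongAW.toList, List.get_eq_getElem, hWs, hW1, hW2, hWp, hWd]
    match i, hi with
    | 0, _ => simpa using h0
    | 1, _ => simpa using h1
    | 2, _ => simpa using h2
    | 3, _ => simpa using h3
    | k + 4, hk =>
      have hk' : k < W.d + 2 := by
        simp only [LongAW.toList, List.length_append, List.length_cons, List.length_nil,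
          List.length_ofFn] at hk
        omega
      rw [h4 k (by omega)]
      simp only [List.cons_append, List.nil_append, List.getElem_cons_succ, List.getElem_ofFn]
      rfl

theorem wf_search : search.Wf := by decide

end Search

end IntervalCompletion

/-! ### The lemma and its polynomial-time algorithm -/

theorem mainTheorem10 :
    (∀ (V : Type*) [Finite V] (G : SimpleGraph V), IntervalCompletion.IsReduced G →
      ∀ s ∈ IntervalCompletion.ST G,
        ∃ W : IntervalCompletion.LongAW G, IntervalCompletion.IsGoodAW G s W) ∧
    (∃ (P : IntervalCompletion.Prog) (p : Polynomial ℕ),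
      ∀ (n : ℕ) (G : SimpleGraph (Fin n)), IntervalCompletion.IsReduced G →
        ∀ s ∈ IntervalCompletion.ST G,
          ∃ (t : ℕ) (σ : IntervalCompletion.State) (W : IntervalCompletion.LongAW G),
            t ≤ p.eval n ∧
            IntervalCompletion.Exec P (IntervalCompletion.inputState G s) t σ ∧
            IntervalCompletion.IsGoodAW G s W ∧ σ.Outputs W.toList) := by
  refine ⟨fun V _ G hG s hs => IntervalCompletion.exists_isGoodAW hG hs,
    IntervalCompletion.Search.search.compile, IntervalCompletion.Search.search.time, ?_⟩
  intro n G hG s hs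
  obtain ⟨t, ht, hexec⟩ := IntervalCompletion.ForProg.exec_compile _
    IntervalCompletion.Search.wf_search (IntervalCompletion.inputState G s)
  obtain ⟨W, hW, hout⟩ := IntervalCompletion.Search.exists_outputs hG hs
  exact ⟨t, _, W, ht, hexec, hW, hout⟩
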